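/- Let $\lambda,c_1,c_2,P,\sigma_0,\beta>0$, $\alpha>2$, $\ell\in[0,1]$ and let $N\ge 1$ be an integer. UAVs are located at $U_i=(X_i,H_i)\in\mathbb{R}^2\times[0,\infty)$, $i\in\mathbb{N}$, where the projections $X_i$ form a homogeneous planar Poisson point process of density $\lambda$ and the altitudes $H_i$ are i.i.d. copies of a random variable $H\ge 0$, independent of the projections (APDL scenario). Let $\Theta_i=\arctan(H_i/\|X_i\|)$ be the elevation angle of $U_i$ and $\rho(\theta)=1/(1+c_2e^{-c_1\theta})$. Given all locations, the link from $U_i$ to the origin is line-of-sight with probability $\rho(\Theta_i)$, independently for different $i$; put $L_i=1$ if it is line-of-sight and $L_i=\ell$ otherwise. The fading gains $G_i\sim\mathrm{Gamma}(N,1)$ (shape $N$, rate $1$) are i.i.d. and independent of all locations and links. For $x\ge 0$ and a random angle $Y\in[0,\pi/2]$ let $$\mathcal{J}_G(x,Y)=1-\mathbb{E}_Y\Big\{\rho(Y)\Big(1+\frac{x\cos^\alpha Y}{N}\Big)^{-N}+[1-\rho(Y)]\Big(1+\frac{x\ell\cos^\alpha Y}{N}\Big)^{-N}\Big\}.$$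 Then $\sum_i G_iL_i\|U_i\|^{-\alpha}<\infty$ almost surely, the integral below converges for every $s>0$, and $$\Psi(s)=\frac1s\exp\Big[-\pi\lambda\int_0^\infty \mathcal{J}_G\big(sz^{-\alpha/2},\arctan(H/\sqrt z)\big)\,dz\Big],\qquad s>0,$$ has an inverse Laplace transform $\mathcal{L}^{-1}\{\Psi\}$, namely a function continuous on $(0,\infty)$ whose Laplace transform is $\Psi(s)$ for all $s>0$ (such a function is unique on $(0,\infty)$). The cell-free downlink coverage under non-coherent joint transmission is, for the gains $G_i/N\sim\mathrm{Gamma}(N,N)$ of unit mean, $$\mathbb{P}\Big[\frac{P\sum_i (G_i/N)L_i\|U_i\|^{-\alpha}}{\sigma_0}\ge\beta\Big]=1-\mathcal{L}^{-1}\{\Psi\}\Big(\frac{\beta\sigma_0}{P}\Big),$$ and, for the gains $G_i\sim\mathrm{Gamma}(N,1)$ themselves, $$\mathbb{P}\Big[\frac{P\sum_i G_iL_i\|U_i\|^{-\alpha}}{\sigma_0}\ge\beta\Big]=1-\mathcal{L}^{-1}\{\Psi\}\Big(\frac{\beta\sigma_0}{NP}\Big).$$ Moreover, for every $x\ge 0$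 and every random angle $Y\in[0,\pi/2]$, $$\lim_{N\to\infty}\mathcal{J}_G(x,Y)=1-\mathbb{E}_Y\big\{\rho(Y)e^{-x\cos^\alpha Y}+[1-\rho(Y)]e^{-x\ell\cos^\alpha Y}\big\}.$$ -/

import Mathlib

open MeasureTheory ProbabilityTheory Filter Topology Set
open scoped ENNReal NNReal

noncomputable section

namespace CellFree

/-- The ground plane with its Euclidean norm. -/
abbrev Plane : Type := EuclideanSpace ℝ (Fin 2)

/-- The number (possibly infinite) of points of the enumerated configuration `x` in `B`. -/
def countIn {E : Type*} (x : ℕ → E) (B : Set E) : ℕ∞ := {i : ℕ | x i ∈ B}.encard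

/-- The random points `X 0, X 1, …` enumerate a Poisson point process with intensity measure `Λ`:
the number of points in a measurable set of finite intensity is Poisson distributed, and the
numbers of points in finitely many pairwise disjoint such sets are independent. -/
structure IsPoissonPointProcess {Ω E : Type*} [MeasurableSpace Ω] [MeasurableSpace E]
    (X : ℕ → Ω → E) (Λ : Measure E) (μ : Measure Ω) : Prop where
  measurable : ∀ i, Measurable (X i)
  count_law : ∀ B : Set E, MeasurableSet B → Λ B ≠ ∞ →
    μ.map (fun ω => countIn (fun i => X i ω) B) =
      (poissonMeasure (Λ B).toNNReal).map (Nat.cast : ℕ → ℕ∞)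
  count_indep : ∀ (n : ℕ) (B : Fin n → Set E), (∀ j, MeasurableSet (B j)) →
    (∀ j, Λ (B j) ≠ ∞) → Pairwise (fun j k => Disjoint (B j) (B k)) →
    iIndepFun (fun j ω => countIn (fun i => X i ω) (B j)) μ

/-- Line-of-sight probability at elevation angle `θ`. -/
def losProb (c₁ c₂ θ : ℝ) : ℝ := 1 / (1 + c₂ * Real.exp (-c₁ * θ))

/-- The position in three-dimensional space (with the Euclidean norm) of the point with
projection `x` and altitude `h`. -/
def position (x : Plane) (h : ℝ) : WithLp 2 (Plane × ℝ) := WithLp.toLp 2 (x, h)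

/-- The elevation angle, seen from the origin, of the point with projection `x` and altitude
`h`. -/
def elevation (x : Plane) (h : ℝ) : ℝ := Real.arctan (h / ‖x‖)

/-- The attenuation factor of a link: `1` with line of sight and `ℓ` without. -/
def linkFactor (ℓ : ℝ) (b : Bool) : ℝ := if b then 1 else ℓ

/-- The network model. UAV `i` has projection `X i` and altitude `H i`; `B i` says whether its
link to the origin is line-of-sight, and `G i` is its fading gain.
The projections form a homogeneous planar Poisson process of density `lam`; the altitudes are
i.i.d. with law `η` on `[0, ∞)` and independent of the projections; given all projections and
altitudes, the links are independently line-of-sight with probability `losProb` of their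
elevation angle; the gains are i.i.d. `Gamma(N, 1)` and independent of everything else. -/
structure IsAPDLNetwork {Ω : Type*} [MeasurableSpace Ω] (μ : Measure Ω) (lam : ℝ)
    (η : Measure ℝ) (c₁ c₂ : ℝ) (N : ℕ)
    (X : ℕ → Ω → Plane) (H : ℕ → Ω → ℝ) (B : ℕ → Ω → Bool) (G : ℕ → Ω → ℝ) : Prop where
  projections : IsPoissonPointProcess X (ENNReal.ofReal lam • (volume : Measure Plane)) μ
  measurable_altitude : ∀ i, Measurable (H i)
  altitude_law : ∀ i, μ.map (H i) = η
  altitude_nonneg : ∀ᵐ h ∂η, 0 ≤ h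
  altitude_indep : iIndepFun H μ
  altitude_projection_indep : IndepFun (fun ω i => X i ω) (fun ω i => H i ω) μ
  measurable_los : ∀ i, Measurable (B i)
  los_law : ∀ S : Finset ℕ,
    μ[fun ω => ∏ i ∈ S, (if B i ω then (1 : ℝ) else 0) |
        MeasurableSpace.comap (fun ω i => (X i ω, H i ω)) inferInstance]
      =ᵐ[μ] fun ω => ∏ i ∈ S, losProb c₁ c₂ (elevation (X i ω) (H i ω))
  measurable_gain : ∀ i, Measurable (G i)
  gain_law : ∀ i, μ.map (G i) = gammaMeasure N 1
  gain_indep : iIndepFun G μ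
  gain_indep_rest : IndepFun (fun ω i => (X i ω, H i ω, B i ω)) (fun ω i => G i ω) μ

/-- The contribution `G_i L_i ‖U_i‖ ^ (-α)` of UAV `i` to the received signal. -/
def signal {Ω : Type*} (α ℓ : ℝ) (X : ℕ → Ω → Plane) (H : ℕ → Ω → ℝ) (B : ℕ → Ω → Bool)
    (G : ℕ → Ω → ℝ) (i : ℕ) (ω : Ω) : ℝ :=
  G i ω * linkFactor ℓ (B i ω) * ‖position (X i ω) (H i ω)‖ ^ (-α)

/-- The cell-free downlink coverage: the probability that the signal-to-noise ratio under
non-coherent joint transmission by all UAVs is at least `β`. -/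
def cellFreeCoverage {Ω : Type*} [MeasurableSpace Ω] (μ : Measure Ω) (P σ₀ β α ℓ : ℝ)
    (X : ℕ → Ω → Plane) (H : ℕ → Ω → ℝ) (B : ℕ → Ω → Bool) (G : ℕ → Ω → ℝ) : ℝ :=
  μ.real {ω | P * (∑' i, signal α ℓ X H B G i ω) / σ₀ ≥ β}

/-- `J_G(x, Y)` for a random angle `Y` with law `ν`. -/
def JG (c₁ c₂ α ℓ : ℝ) (N : ℕ) (x : ℝ) (ν : Measure ℝ) : ℝ :=
  1 - ∫ y, (losProb c₁ c₂ y * (1 + x * Real.cos y ^ α / N) ^ (-(N : ℤ))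
    + (1 - losProb c₁ c₂ y) * (1 + x * Real.cos y ^ α * ℓ / N) ^ (-(N : ℤ))) ∂ν

/-- The law of the angle `arctan (H / √z)` for a random altitude `H` with law `η`. -/
def angleLaw (η : Measure ℝ) (z : ℝ) : Measure ℝ :=
  η.map (fun h => Real.arctan (h / Real.sqrt z))

/-- The function `s ↦ (1 / s) exp [-π λ ∫_0^∞ J_G(s z ^ (-α / 2), arctan (H / √z)) dz]`. -/
def coverageTransform (lam : ℝ) (η : Measure ℝ) (c₁ c₂ α ℓ : ℝ) (N : ℕ) (s : ℝ) : ℝ :=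
  1 / s * Real.exp (-(Real.pi * lam *
    ∫ z in Ioi (0 : ℝ), JG c₁ c₂ α ℓ N (s * z ^ (-(α / 2))) (angleLaw η z)))

/-- `f` is an inverse Laplace transform of `g`: it is continuous on `(0, ∞)` and its Laplace
transform converges to `g s` for every `s > 0`. By Lerch's theorem there is at most one such
function on `(0, ∞)`. -/
def IsInverseLaplace (g f : ℝ → ℝ) : Prop :=
  ContinuousOn f (Ioi 0) ∧ ∀ s > 0,
    IntegrableOn (fun t => Real.exp (-s * t) * f t) (Ioi 0) ∧
      ∫ t in Ioi (0 : ℝ), Real.exp (-s * t) * f t = g s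

open Classical in
/-- The inverse Laplace transform of `g`, as a function on `(0, ∞)` (zero if there is none). -/
def inverseLaplace (g : ℝ → ℝ) : ℝ → ℝ :=
  if h : ∃ f, IsInverseLaplace g f then h.choose else 0

end CellFree

end

open CellFree

open MeasureTheory ProbabilityTheory Filter Topology Set
open scoped ENNReal NNReal

namespace CellFree

/-! ### Probability generating functional of a Poisson process. -/

section PoissonFunctional

/-! Let `Z` be the series with the gains `G i / N`. Everything follows from its Laplace transform.

In `[0, ∞]`, `exp (-s Z)` is the infimum of decreasing finite products, so no convergence is needed
beforehand. In each finite product the gains are integrated out first (gamma transform `(1 + a / N)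
^ (-N)`), then the link indicators are replaced by their conditional probabilities
(`lintegral_prod_mixture`), then the altitudes are averaged. What remains is a product of `1 -
defect ‖X i‖`, and the generating functional `IsPoissonPointProcess.lintegral_iInf_prod` turns its
infinite version into `exp (-λ ∫ defect ‖x‖ dx)`. Polar coordinates with `z = r ^ 2` give the
exponent of Ψ (`JG_eq_defect`).

As `s ↓ 0` the exponent tends to 0 by domination with a multiple of `min 1 (z ^ (-α / 2))`,
integrable because `α > 2`; hence `Z` converges almost surely. By Fubini, dividing the transform by
`s` gives the transform of the distribution function of `Z`. That function is continuous on `(0,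
∞)`: given the coefficients, a single gain with positive coefficient already smooths the sum
(`measure_tsum_eq_zero`). Lerch's theorem then identifies it with the chosen inverse transform, and
coverage is its complement. The gains `G i` only rescale the threshold by `N`. The limit of many
antennas is `(1 + a / N) ^ N → exp a` under bounded convergence. -/

lemma lintegral_pow_poissonMeasure (r : ℝ≥0) {c : ℝ≥0∞} (hc : c ≤ 1) :
    ∫⁻ n : ℕ, (1 - c) ^ n ∂(poissonMeasure r)
      = ENNReal.ofReal (Real.exp (-(r * c.toReal))) := by
  have hc' : c ≠ ∞ := ne_top_of_le_ne_top ENNReal.one_ne_top hc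
  obtain ⟨q, rfl⟩ : ∃ q : ℝ≥0, c = q := ⟨c.toNNReal, (ENNReal.coe_toNNReal hc').symm⟩
  have hq : (q : ℝ) ≤ 1 := by exact_mod_cast hc
  have h1 : (1 - (q : ℝ≥0∞)) = ENNReal.ofReal (1 - (q : ℝ)) := by
    rw [ENNReal.ofReal_sub _ q.coe_nonneg]; simp
  rw [poissonMeasure, lintegral_sum_measure]
  simp only [lintegral_smul_measure, lintegral_dirac, h1, smul_eq_mul]
  have h2 : ∀ n : ℕ, ENNReal.ofReal (Real.exp (-r) * r ^ n / n.factorial) *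
      ENNReal.ofReal (1 - (q : ℝ)) ^ n =
      ENNReal.ofReal (Real.exp (-r) * ((r * (1 - q)) ^ n / n.factorial)) := by
    intro n
    rw [← ENNReal.ofReal_pow (by linarith), ← ENNReal.ofReal_mul (by positivity)]
    congr 1
    rw [mul_pow]; ring
  have hs : HasSum (fun n : ℕ => Real.exp (-r) * ((r * (1 - q) : ℝ) ^ n / n.factorial))
      (Real.exp (-r) * Real.exp (r * (1 - q))) := by
    rw [Real.exp_eq_exp_ℝ]
    exact (NormedSpace.expSeries_div_hasSum_exp (𝔸 := ℝ) _).mul_left _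
  have hq' : (0 : ℝ) ≤ 1 - q := by linarith
  simp only [h2]
  rw [← ENNReal.ofReal_tsum_of_nonneg (fun n => by positivity) hs.summable, hs.tsum_eq,
    ← Real.exp_add]
  congr 2
  simp; ring

variable {Ω E : Type*} [MeasurableSpace Ω] [MeasurableSpace E] {X : ℕ → Ω → E} {Λ : Measure E}
  {μ : Measure Ω}

lemma IsPoissonPointProcess.measurable_countIn (h : IsPoissonPointProcess X Λ μ) {B : Set E}
    (hB : MeasurableSet B) : Measurable fun ω => countIn (fun i => X i ω) B := by
  refine measurable_encard.comp ?_
  exact measurable_set_iff.2 fun i => (measurable_mem.2 hB).comp (h.measurable i)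

lemma IsPoissonPointProcess.lintegral_count (h : IsPoissonPointProcess X Λ μ) {B : Set E}
    (hB : MeasurableSet B) (hΛ : Λ B ≠ ∞) (f : ℕ∞ → ℝ≥0∞) :
    ∫⁻ ω, f (countIn (fun i => X i ω) B) ∂μ
      = ∫⁻ n : ℕ, f n ∂(poissonMeasure (Λ B).toNNReal) := by
  rw [← lintegral_map (f := f) (Measurable.of_discrete) (h.measurable_countIn hB),
    h.count_law B hB hΛ, lintegral_map Measurable.of_discrete Measurable.of_discrete]

/-- The count has the law of a natural number cast to `ℕ∞`, which gives no mass to `⊤`. -/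
lemma IsPoissonPointProcess.ae_countIn_ne_top (h : IsPoissonPointProcess X Λ μ) {B : Set E}
    (hB : MeasurableSet B) (hΛ : Λ B ≠ ∞) :
    ∀ᵐ ω ∂μ, {i | X i ω ∈ B}.Finite := by
  have h1 := h.lintegral_count hB hΛ (fun n => if n = ⊤ then 1 else 0)
  simp only [ENat.natCast_ne_top, if_false, lintegral_zero] at h1
  have hm : Measurable fun ω => (if countIn (fun i => X i ω) B = ⊤ then (1 : ℝ≥0∞) else 0) :=
    (Measurable.of_discrete (f := fun n : ℕ∞ => if n = ⊤ then (1 : ℝ≥0∞) else 0)).comp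
      (h.measurable_countIn hB)
  rw [lintegral_eq_zero_iff hm] at h1
  filter_upwards [h1] with ω hω
  by_contra hinf
  have : countIn (fun i => X i ω) B = ⊤ := Set.encard_eq_top hinf
  simp [this] at hω

lemma antitone_prod_range {a : ℕ → ℝ≥0∞} (ha : ∀ i, a i ≤ 1) :
    Antitone fun n => ∏ i ∈ Finset.range n, a i :=
  antitone_nat_of_succ_le fun n => by
    rw [Finset.prod_range_succ]
    exact mul_le_of_le_one_right' (ha n)

lemma iInf_prod_range_eq {a : ℕ → ℝ≥0∞} (ha : ∀ i, a i ≤ 1) {T : Finset ℕ}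
    (hT : ∀ i ∉ T, a i = 1) : ⨅ n, ∏ i ∈ Finset.range n, a i = ∏ i ∈ T, a i := by
  obtain ⟨m, hm⟩ := T.exists_nat_subset_range
  have h1 : ∏ i ∈ Finset.range m, a i = ∏ i ∈ T, a i :=
    (Finset.prod_subset hm fun i _ hi => hT i hi).symm
  refine le_antisymm (h1 ▸ iInf_le _ m) (le_iInf fun n => ?_)
  rw [← h1]
  rcases le_total n m with hnm | hnm
  · exact antitone_prod_range ha hnm
  · rw [h1, ← Finset.prod_subset (hm.trans (Finset.range_mono hnm)) fun i _ hi => hT i hi]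

/-- Grouping the points by the value of `φ` turns the product into `∏ (1 - v) ^ count`. The level
sets are disjoint, so the counts are independent Poisson variables, and each contributes `exp (-v
Λ(φ = v))`. -/
lemma IsPoissonPointProcess.lintegral_iInf_prod_simpleFunc [IsProbabilityMeasure μ]
    (h : IsPoissonPointProcess X Λ μ) (φ : SimpleFunc E ℝ≥0∞) (hle : ∀ x, φ x ≤ 1)
    (hfin : φ.lintegral Λ ≠ ∞) :
    ∫⁻ ω, ⨅ n, ∏ i ∈ Finset.range n, (1 - φ (X i ω)) ∂μ
      = ENNReal.ofReal (Real.exp (-(φ.lintegral Λ).toReal)) := by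
  classical
  -- The value 0 is left out: its level set may have infinite intensity, but its points only
  -- contribute factors 1.
  set S : Finset ℝ≥0∞ := φ.range.filter (· ≠ 0) with hS
  have hBfin : ∀ v ∈ S, Λ (φ ⁻¹' {v}) ≠ ∞ := fun v hv =>
    ((SimpleFunc.finMeasSupp_iff.1 (SimpleFunc.FinMeasSupp.of_lintegral_ne_top hfin)) v
      (Finset.mem_filter.1 hv).2).ne
  have hBm : ∀ v, MeasurableSet (φ ⁻¹' {v}) := fun v => φ.measurableSet_preimage _
  have hS1 : ∀ v ∈ S, v ≤ 1 := by
    intro v hv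
    obtain ⟨x, rfl⟩ := SimpleFunc.mem_range.1 (Finset.mem_filter.1 hv).1
    exact hle x
  have hae : ∀ᵐ ω ∂μ, ∀ v ∈ S, {i | X i ω ∈ φ ⁻¹' {v}}.Finite :=
    (ae_ball_iff S.countable_toSet).2 fun v hv => h.ae_countIn_ne_top (hBm v) (hBfin v hv)
  have hrw : ∀ᵐ ω ∂μ, ⨅ n, ∏ i ∈ Finset.range n, (1 - φ (X i ω)) =
      ∏ v ∈ S, (1 - v) ^ (countIn (fun i => X i ω) (φ ⁻¹' {v})).toNat := by
    filter_upwards [hae] with ω hω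
    have hTf : {i | φ (X i ω) ≠ 0}.Finite := by
      refine (S.finite_toSet.biUnion hω).subset fun i hi => ?_
      simp only [mem_iUnion]
      exact ⟨φ (X i ω), by simpa [hS] using hi, by simp⟩
    rw [iInf_prod_range_eq (T := hTf.toFinset) (fun i => tsub_le_self)
      (fun i hi => by
        have : φ (X i ω) = 0 := by simpa using hi
        simp [this])]
    rw [← Finset.prod_fiberwise_of_maps_to (t := S) (g := fun i => φ (X i ω))
      (fun i hi => by simpa [hS] using hi)]
    refine Finset.prod_congr rfl fun v hv => ?_
    rw [Finset.prod_congr rfl (g := fun _ => 1 - v)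
      (fun i hi => by rw [(Finset.mem_filter.1 hi).2]), Finset.prod_const]
    congr 1
    have : {i | X i ω ∈ φ ⁻¹' {v}} = ((hTf.toFinset.filter fun i => φ (X i ω) = v : Finset ℕ) :
        Set ℕ) := by
      ext i
      simp only [mem_preimage, mem_singleton_iff, mem_ofPred_eq, Finset.coe_filter,
        Finite.mem_toFinset]
      constructor
      · intro hi
        exact ⟨hi ▸ (Finset.mem_filter.1 hv).2, hi⟩
      · exact fun hi => hi.2
    rw [countIn, this, Set.encard_coe_eq_coe_finsetCard, ENat.toNat_natCast]
  rw [lintegral_congr_ae hrw]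
  have hind : iIndepFun (fun (v : S) ω => countIn (fun i => X i ω) (φ ⁻¹' {v.1})) μ := by
    have h0 := h.count_indep S.card (fun j => φ ⁻¹' {(S.equivFin.symm j).1}) (fun j => hBm _)
      (fun j => hBfin _ (S.equivFin.symm j).2) (fun j k hjk => by
        refine Disjoint.preimage _ (Set.disjoint_singleton.2 fun hh => hjk ?_)
        exact S.equivFin.symm.injective (Subtype.ext hh))
    have := h0.precomp (g := S.equivFin) S.equivFin.injective
    simpa using this
  have hind2 := hind.comp (fun v n => (1 - v.1) ^ n.toNat) (fun v => Measurable.of_discrete)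
  have hconv : ∀ ω, ∏ v ∈ S, (1 - v) ^ (countIn (fun i => X i ω) (φ ⁻¹' {v})).toNat =
      ∏ v : S, (1 - v.1) ^ (countIn (fun i => X i ω) (φ ⁻¹' {v.1})).toNat := fun ω =>
    (Finset.prod_coe_sort S _).symm
  simp only [hconv]
  simp only [Function.comp_def] at hind2
  rw [lintegral_prod_eq_prod_lintegral_of_indepFun (X := fun (v : S) ω =>
      (1 - v.1) ^ (countIn (fun i => X i ω) (φ ⁻¹' {v.1})).toNat) _ hind2
    (fun v => (Measurable.of_discrete (f := fun n : ℕ∞ => (1 - v.1) ^ n.toNat)).comp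
      (h.measurable_countIn (hBm v.1)))]
  have hterm : ∀ v : S, ∫⁻ ω, (1 - v.1) ^ (countIn (fun i => X i ω) (φ ⁻¹' {v.1})).toNat ∂μ =
      ENNReal.ofReal (Real.exp (-((v.1 * Λ (φ ⁻¹' {v.1})).toReal))) := by
    intro v
    rw [h.lintegral_count (hBm _) (hBfin _ v.2) (fun n => (1 - v.1) ^ n.toNat)]
    simp only [ENat.toNat_natCast]
    rw [lintegral_pow_poissonMeasure _ (hS1 _ v.2), ENNReal.toReal_mul, mul_comm]
    rfl
  simp only [hterm]
  rw [← ENNReal.ofReal_prod_of_nonneg (fun _ _ => (Real.exp_pos _).le), ← Real.exp_sum]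
  congr 2
  rw [Finset.sum_neg_distrib, Finset.sum_coe_sort S (fun v => (v * Λ (φ ⁻¹' {v})).toReal),
    ← ENNReal.toReal_sum (fun v hv => ENNReal.mul_ne_top
      (ne_top_of_le_ne_top ENNReal.one_ne_top (hS1 v hv)) (hBfin v hv)), hS]
  rw [SimpleFunc.lintegral, Finset.sum_filter_of_ne]
  intro v _ hv hv0
  simp [hv0] at hv

/-- Allows passing from simple functions to their supremum. Multiplication is continuous along the
decreasing factors because they are bounded by 1, away from the indeterminate `0 * ∞`. -/
lemma iInf_prod_range_iInf (a : ℕ → ℕ → ℝ≥0∞) (ha : ∀ k i, a k i ≤ 1)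
    (hanti : ∀ i, Antitone fun k => a k i) :
    ⨅ k, ⨅ n, ∏ i ∈ Finset.range n, a k i = ⨅ n, ∏ i ∈ Finset.range n, ⨅ k, a k i := by
  rw [iInf_comm]
  refine iInf_congr fun n => ?_
  refine tendsto_nhds_unique (tendsto_atTop_iInf fun k l hkl =>
    Finset.prod_le_prod' fun i _ => hanti i hkl) ?_
  induction n with
  | zero => simp
  | succ n ih =>
    simp only [Finset.prod_range_succ]
    refine ENNReal.Tendsto.mul ih (Or.inr ?_) (tendsto_atTop_iInf (hanti n)) (Or.inr ?_)
    · exact ne_top_of_le_ne_top ENNReal.one_ne_top ((iInf_le _ 0).trans (ha 0 n))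
    · refine ne_top_of_le_ne_top ENNReal.one_ne_top (Finset.prod_le_one' fun i _ => ?_)
      exact (iInf_le _ 0).trans (ha 0 i)

/-- The probability generating functional of a Poisson point process. -/
theorem IsPoissonPointProcess.lintegral_iInf_prod [IsProbabilityMeasure μ]
    (h : IsPoissonPointProcess X Λ μ) {φ : E → ℝ≥0∞} (hφ : Measurable φ) (hle : ∀ x, φ x ≤ 1)
    (hfin : ∫⁻ x, φ x ∂Λ ≠ ∞) :
    ∫⁻ ω, ⨅ n, ∏ i ∈ Finset.range n, (1 - φ (X i ω)) ∂μ
      = ENNReal.ofReal (Real.exp (-(∫⁻ x, φ x ∂Λ).toReal)) := by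
  set f := fun k => SimpleFunc.eapprox φ k
  have hfle : ∀ k x, f k x ≤ φ x := fun k x => by
    rw [← SimpleFunc.iSup_eapprox_apply hφ x]; exact le_iSup (fun k => f k x) k
  have hfmono : ∀ x, Monotone fun k => f k x := fun x k l hkl => SimpleFunc.monotone_eapprox φ hkl x
  have hsup : ∀ x, ⨅ k, (1 - f k x) = 1 - φ x := fun x => by
    rw [← ENNReal.sub_iSup ENNReal.one_ne_top, SimpleFunc.iSup_eapprox_apply hφ x]
  have hrw : ∀ ω, ⨅ n, ∏ i ∈ Finset.range n, (1 - φ (X i ω)) =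
      ⨅ k, ⨅ n, ∏ i ∈ Finset.range n, (1 - f k (X i ω)) := fun ω => by
    rw [iInf_prod_range_iInf (fun k i => 1 - f k (X i ω)) (fun _ _ => tsub_le_self)
      (fun i k l hkl => tsub_le_tsub_left (hfmono _ hkl) _)]
    simp only [hsup]
  have hmono : Monotone fun k => (f k).lintegral Λ := fun k l hkl =>
    SimpleFunc.lintegral_mono (SimpleFunc.monotone_eapprox φ hkl) le_rfl
  have hlim : Tendsto (fun k => (f k).lintegral Λ) atTop (𝓝 (∫⁻ x, φ x ∂Λ)) := by
    rw [lintegral_eq_iSup_eapprox_lintegral hφ]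
    exact tendsto_atTop_iSup hmono
  have hkfin : ∀ k, (f k).lintegral Λ ≠ ∞ := fun k => by
    refine ne_top_of_le_ne_top hfin ?_
    rw [← SimpleFunc.lintegral_eq_lintegral]
    exact lintegral_mono (hfle k)
  simp only [hrw]
  have hanti : Antitone fun k ω => ⨅ n, ∏ i ∈ Finset.range n, (1 - f k (X i ω)) :=
    fun k l hkl ω => iInf_mono fun n => Finset.prod_le_prod' fun i _ =>
      tsub_le_tsub_left (hfmono _ hkl) _
  have hmeas : ∀ k, Measurable fun ω => ⨅ n, ∏ i ∈ Finset.range n, (1 - f k (X i ω)) := fun k =>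
    Measurable.iInf fun n => Finset.measurable_fun_prod _ fun i _ =>
      ((f k).measurable.comp (h.measurable i)).const_sub _
  rw [lintegral_iInf hmeas hanti]
  · refine tendsto_nhds_unique (tendsto_atTop_iInf fun k l hkl => lintegral_mono (hanti hkl)) ?_
    simp only [fun k => h.lintegral_iInf_prod_simpleFunc (f k)
      (fun x => (hfle k x).trans (hle x)) (hkfin k)]
    refine ENNReal.tendsto_ofReal ((Real.continuous_exp.tendsto _).comp (Tendsto.neg ?_))
    exact (ENNReal.tendsto_toReal hfin).comp hlim
  · refine ne_top_of_le_ne_top ENNReal.one_ne_top ?_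
    calc _ ≤ ∫⁻ _, 1 ∂μ := lintegral_mono fun ω => (iInf_le _ 0).trans (by simp)
      _ = 1 := by simp

end PoissonFunctional

end CellFree

namespace CellFree

/-! ### Independent marks, and absence of atoms in random series. -/

section IndependentMarks

variable {Ω E F : Type*} [MeasurableSpace Ω] [MeasurableSpace E] [MeasurableSpace F]
  {μ : Measure Ω} [IsProbabilityMeasure μ]

/-- Integrating out independent, identically distributed marks. -/
lemma lintegral_prod_of_indep_marks {V : ℕ → Ω → E} {W : ℕ → Ω → F} {η : Measure F}
    (hV : ∀ i, Measurable (V i)) (hW : ∀ i, Measurable (W i)) (hlaw : ∀ i, μ.map (W i) = η)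
    (hiW : iIndepFun W μ) (hVW : IndepFun (fun ω i => V i ω) (fun ω i => W i ω) μ)
    {k : E → F → ℝ≥0∞} (hk : Measurable (Function.uncurry k)) (n : ℕ) :
    ∫⁻ ω, ∏ i ∈ Finset.range n, k (V i ω) (W i ω) ∂μ
      = ∫⁻ ω, ∏ i ∈ Finset.range n, ∫⁻ w, k (V i ω) w ∂η ∂μ := by
  have hη : IsProbabilityMeasure η := hlaw 0 ▸ Measure.isProbabilityMeasure_map (hW 0).aemeasurable
  have hV' : Measurable fun ω i => V i ω := measurable_pi_iff.2 hV
  have hW' : Measurable fun ω i => W i ω := measurable_pi_iff.2 hW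
  have hkm : Measurable fun p : (ℕ → E) × (ℕ → F) =>
      ∏ i ∈ Finset.range n, k (p.1 i) (p.2 i) := by
    refine Finset.measurable_fun_prod _ fun i _ => ?_
    change Measurable (Function.uncurry k ∘ fun p : (ℕ → E) × (ℕ → F) => (p.1 i, p.2 i))
    exact hk.comp (by fun_prop)
  have h1 : ∫⁻ ω, ∏ i ∈ Finset.range n, k (V i ω) (W i ω) ∂μ =
      ∫⁻ p, ∏ i ∈ Finset.range n, k (p.1 i) (p.2 i)
        ∂(μ.map fun ω => ((fun i => V i ω), (fun i => W i ω))) := by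
    rw [lintegral_map hkm (hV'.prodMk hW')]
  have : IsProbabilityMeasure (μ.map fun ω i => W i ω) :=
    Measure.isProbabilityMeasure_map hW'.aemeasurable
  rw [h1, (indepFun_iff_map_prod_eq_prod_map_map hV'.aemeasurable hW'.aemeasurable).1 hVW,
    lintegral_prod _ hkm.aemeasurable]
  have h2 : ∀ v : ℕ → E, ∫⁻ w, ∏ i ∈ Finset.range n, k (v i) (w i) ∂(μ.map fun ω i => W i ω) =
      ∏ i ∈ Finset.range n, ∫⁻ w, k (v i) w ∂η := by
    intro v
    have hki : ∀ i, Measurable fun w => k (v i) w := fun i => hk.comp measurable_prodMk_left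
    rw [lintegral_map (f := fun w : ℕ → F => ∏ i ∈ Finset.range n, k (v i) (w i))
        (hkm.comp measurable_prodMk_left) hW',
      lintegral_prod_eq_prod_lintegral_of_indepFun (X := fun i ω => k (v i) (W i ω)) _
        (hiW.comp _ hki) (fun i => (hki i).comp (hW i))]
    refine Finset.prod_congr rfl fun i _ => ?_
    rw [← hlaw i, lintegral_map (hki i) (hW i)]
  simp only [h2]
  rw [lintegral_map _ hV']
  exact Finset.measurable_fun_prod _ fun i _ =>
    (Measurable.lintegral_prod_right hk).comp (measurable_pi_apply i)

/-- A series with independent, positive, non-atomic coefficients has no atom at a positive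
point. -/
lemma measure_tsum_eq_zero {C G : ℕ → Ω → ℝ} (hC : ∀ i, Measurable (C i))
    (hG : ∀ i, Measurable (G i)) (hGpos : ∀ i, ∀ᵐ ω ∂μ, 0 < G i ω)
    (hatom : ∀ i, NullSingletonClass (μ.map (G i))) (hiG : iIndepFun G μ)
    (hCG : IndepFun (fun ω i => C i ω) (fun ω i => G i ω) μ) {t : ℝ} (ht : 0 < t) :
    μ {ω | ∑' i, ENNReal.ofReal (C i ω * G i ω) = ENNReal.ofReal t} = 0 := by
  have hC' : Measurable fun ω i => C i ω := measurable_pi_iff.2 hC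
  have hG' : Measurable fun ω i => G i ω := measurable_pi_iff.2 hG
  have hA : Measurable fun p : (ℕ → ℝ) × (ℕ → ℝ) => ∑' i, ENNReal.ofReal (p.1 i * p.2 i) :=
    Measurable.tsum fun i => by fun_prop
  have hAm : MeasurableSet {p : (ℕ → ℝ) × (ℕ → ℝ) |
      ∑' i, ENNReal.ofReal (p.1 i * p.2 i) = ENNReal.ofReal t} := hA (measurableSet_singleton _)
  have : IsProbabilityMeasure (μ.map fun ω i => G i ω) :=
    Measure.isProbabilityMeasure_map hG'.aemeasurable
  have key : (μ.map fun ω => ((fun i => C i ω), (fun i => G i ω)))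
      {p : (ℕ → ℝ) × (ℕ → ℝ) |
        ∑' i, ENNReal.ofReal (p.1 i * p.2 i) = ENNReal.ofReal t} = 0 := by
    rw [(indepFun_iff_map_prod_eq_prod_map_map hC'.aemeasurable hG'.aemeasurable).1 hCG,
      Measure.measure_prod_null hAm]
    refine Eventually.of_forall fun c => ?_
    have hAc : MeasurableSet (Prod.mk c ⁻¹' {p : (ℕ → ℝ) × (ℕ → ℝ) |
      ∑' i, ENNReal.ofReal (p.1 i * p.2 i) = ENNReal.ofReal t}) := measurable_prodMk_left hAm
    simp only [Pi.zero_apply]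
    rw [Measure.map_apply hG' hAc]
    simp only [preimage_ofPred_eq]
    by_cases hc : ∃ i, 0 < c i
    · obtain ⟨i, hi⟩ := hc
      -- The rest of the series depends only on the other gains, hence is independent of `G i`; with
      -- values in `[0, ∞]` it needs no summability.
      set R : Ω → ℝ≥0∞ := fun ω => ∑' j, if j = i then 0 else ENNReal.ofReal (c j * G j ω) with hR
      have hRle : Measurable[⨆ j ∈ ({i}ᶜ : Set ℕ), MeasurableSpace.comap (G j) inferInstance] R := by
        refine @Measurable.tsum _ _ _ (_) _ _ _ _ _ _ _ _ _ _ _ _ fun j => ?_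
        by_cases hj : j = i
        · simp only [hj, if_true]; exact @measurable_const _ _ _ _ _
        · simp only [hj, if_false]
          refine (by fun_prop : Measurable fun x : ℝ => ENNReal.ofReal (c j * x)).comp ?_
          refine Measurable.mono ?_ (le_iSup₂_of_le j hj le_rfl) le_rfl
          exact comap_measurable _
      have hRm : Measurable R := Measurable.tsum fun j => by
        by_cases hj : j = i
        · simp only [hj, if_true]; exact measurable_const
        · simp only [hj, if_false]; have := hG j; fun_prop
      have hind : IndepFun R (G i) μ := by
        have := indep_iSup_of_disjoint (fun j => (hG j).comap_le) hiG
          (disjoint_compl_left (a := ({i} : Set ℕ)))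
        rw [IndepFun_iff_Indep]
        refine indep_of_indep_of_le_left (indep_of_indep_of_le_right this ?_) hRle.comap_le
        exact le_iSup₂_of_le i rfl le_rfl
      have hsplit : ∀ ω, ∑' j, ENNReal.ofReal (c j * G j ω) =
          ENNReal.ofReal (c i * G i ω) + R ω := fun ω =>
        (ENNReal.tsum_eq_add_tsum_ite (f := fun j => ENNReal.ofReal (c j * G j ω)) i).trans
          (by simp only [hR]; congr!)
      have hS : MeasurableSet {p : ℝ≥0∞ × ℝ |
          ENNReal.ofReal (c i * p.2) + p.1 = ENNReal.ofReal t ∧ 0 < p.2} := by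
        refine MeasurableSet.inter ?_ (measurableSet_lt measurable_const measurable_snd)
        exact measurableSet_eq_fun (by fun_prop) measurable_const
      have hz : μ {ω | (R ω, G i ω) ∈ {p : ℝ≥0∞ × ℝ |
          ENNReal.ofReal (c i * p.2) + p.1 = ENNReal.ofReal t ∧ 0 < p.2}} = 0 := by
        have h0 := Measure.map_apply (μ := μ) (hRm.prodMk (hG i)) hS
        rw [(indepFun_iff_map_prod_eq_prod_map_map hRm.aemeasurable (hG i).aemeasurable).1 hind]
          at h0
        refine h0.symm.trans ?_
        have : IsProbabilityMeasure (μ.map (G i)) :=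
          Measure.isProbabilityMeasure_map (hG i).aemeasurable
        rw [Measure.measure_prod_null hS]
        refine Eventually.of_forall fun r => ?_
        have := hatom i
        -- Given the rest `r`, at most one positive gain completes the sum to `t`, and single points
        -- are null for the law of `G i`.
        refine Set.Subsingleton.measure_zero (fun x hx y hy => ?_) _
        obtain ⟨hx1, hx2⟩ := hx
        obtain ⟨hy1, hy2⟩ := hy
        simp only at hx1 hx2 hy1 hy2
        have hr : r ≠ ∞ := by
          rintro rfl
          simp at hx1
        have := (ENNReal.add_left_inj hr).1 (hx1.trans hy1.symm)
        rw [ENNReal.ofReal_eq_ofReal_iff (by positivity) (by positivity)] at this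
        exact mul_left_cancel₀ hi.ne' this
      refine measure_mono_null_ae ?_ hz
      filter_upwards [hGpos i] with ω hω h1
      exact ⟨(hsplit ω).symm.trans h1, hω⟩
    -- Without a positive coefficient every truncated term vanishes, so the sum is 0 and not `t >
    -- 0`.
    · push Not at hc
      have : ∀ᵐ ω ∂μ, ¬ (∑' i, ENNReal.ofReal (c i * G i ω) = ENNReal.ofReal t) := by
        filter_upwards [ae_all_iff.2 hGpos] with ω hω h1
        have h2 : ∀ i, ENNReal.ofReal (c i * G i ω) = 0 := fun i =>
          ENNReal.ofReal_of_nonpos (mul_nonpos_of_nonpos_of_nonneg (hc i) (hω i).le)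
        simp only [h2, tsum_zero] at h1
        exact (ENNReal.ofReal_pos.2 ht).ne h1
      simpa [ae_iff] using this
  rwa [Measure.map_apply (hC'.prodMk hG') hAm] at key

end IndependentMarks

/-! ### Gamma distribution. -/

section Gamma

/-- Exponential tilting: the tilted density is a constant times the gamma density of rate `r + c`,
which has mass 1. -/
lemma lintegral_exp_neg_gammaMeasure {a r c : ℝ} (ha : 0 < a) (hr : 0 < r) (hc : 0 ≤ c) :
    ∫⁻ x, ENNReal.ofReal (Real.exp (-(c * x))) ∂(gammaMeasure a r)
      = ENNReal.ofReal ((r / (r + c)) ^ a) := by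
  have hrc : 0 < r + c := by linarith
  have hm : Measurable (gammaPDF a r) := (measurable_gammaPDFReal a r).ennreal_ofReal
  rw [gammaMeasure, lintegral_withDensity_eq_lintegral_mul _ hm (by fun_prop)]
  have h : ∀ x, (gammaPDF a r * fun x => ENNReal.ofReal (Real.exp (-(c * x)))) x =
      ENNReal.ofReal ((r / (r + c)) ^ a) * gammaPDF a (r + c) x := by
    intro x
    rcases lt_or_ge x 0 with hx | hx
    · simp [gammaPDF_of_neg hx]
    · rw [Pi.mul_apply, gammaPDF_of_nonneg hx, gammaPDF_of_nonneg hx,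
        ← ENNReal.ofReal_mul (by positivity), ← ENNReal.ofReal_mul (by positivity)]
      congr 1
      rw [Real.div_rpow hr.le hrc.le, show -((r + c) * x) = -(r * x) + -(c * x) by ring,
        Real.exp_add]
      have := (Real.rpow_pos_of_pos hrc a).ne'
      field_simp
  simp only [h]
  rw [lintegral_const_mul' _ _ ENNReal.ofReal_ne_top, lintegral_gammaPDF_eq_one ha hrc, mul_one]

lemma nullSingletonClass_gammaMeasure (a r : ℝ) : NullSingletonClass (gammaMeasure a r) :=
  ⟨fun x => withDensity_absolutelyContinuous _ _ (measure_singleton x)⟩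

lemma ae_pos_gammaMeasure (a r : ℝ) : ∀ᵐ x ∂(gammaMeasure a r), 0 < x := by
  have h : gammaMeasure a r (Iic 0) = 0 := by
    rw [gammaMeasure, withDensity_apply _ measurableSet_Iic,
      setLIntegral_congr Iio_ae_eq_Iic.symm]
    exact lintegral_gammaPDF_of_nonpos le_rfl
  rw [ae_iff]
  simp only [not_lt]
  exact h

end Gamma

end CellFree

namespace CellFree

/-! ### Uniqueness of Laplace transforms. -/

section Lerch

/-- A bounded, injective, continuous extension of `t ↦ exp (-t)` from `[0, ∞)` to `ℝ`. -/
noncomputable def expNegExt : BoundedContinuousFunction ℝ ℝ :=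
  BoundedContinuousFunction.ofNormedAddCommGroup
    (fun t => Real.exp (-max t 0) + (1 - Real.exp (min t 0))) (by fun_prop) 2 (fun t => by
      have h1 : Real.exp (-max t 0) ≤ 1 := Real.exp_le_one_iff.2 (by simp)
      have h2 : Real.exp (min t 0) ≤ 1 := Real.exp_le_one_iff.2 (by simp)
      have h3 := Real.exp_pos (-max t 0)
      have h4 := Real.exp_pos (min t 0)
      rw [Real.norm_eq_abs, abs_le]
      constructor <;> linarith)

lemma expNegExt_apply (t : ℝ) :
    expNegExt t = Real.exp (-max t 0) + (1 - Real.exp (min t 0)) := rfl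

lemma expNegExt_of_pos {t : ℝ} (ht : 0 < t) : expNegExt t = Real.exp (-t) := by
  simp [expNegExt_apply, max_eq_left ht.le, min_eq_right ht.le]

lemma expNegExt_strictAnti : StrictAnti expNegExt := by
  intro x y hxy
  simp only [expNegExt_apply]
  rcases lt_or_ge 0 y with hy | hy
  · have h1 : Real.exp (-max y 0) < Real.exp (-max x 0) :=
      Real.exp_lt_exp.2 (neg_lt_neg (by rw [max_eq_left hy.le]; exact max_lt hxy hy))
    have h2 : Real.exp (min x 0) ≤ Real.exp (min y 0) :=
      Real.exp_le_exp.2 (min_le_min hxy.le le_rfl)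
    linarith
  · have h1 : Real.exp (-max y 0) ≤ Real.exp (-max x 0) :=
      Real.exp_le_exp.2 (neg_le_neg (max_le_max hxy.le le_rfl))
    have h2 : Real.exp (min x 0) < Real.exp (min y 0) :=
      Real.exp_lt_exp.2 (by rw [min_eq_left hy]; exact min_lt_of_left_lt hxy)
    linarith

/-- Finite measures on the line are determined by the moments of `expNegExt`. -/
lemma ext_of_integral_expNegExt_pow {P Q : Measure ℝ} [IsFiniteMeasure P] [IsFiniteMeasure Q]
    (h : ∀ n : ℕ, ∫ t, expNegExt t ^ n ∂P = ∫ t, expNegExt t ^ n ∂Q) : P = Q := by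
  -- Polynomials in `expNegExt` separate points because `expNegExt` is injective on all of `ℝ`; by
  -- linearity, their integrals are determined by the moments.
  let A : StarSubalgebra ℝ (BoundedContinuousFunction ℝ ℝ) :=
    { Algebra.adjoin ℝ {expNegExt} with
      star_mem' := fun {f} hf => by
        have : star f = f := by ext; simp
        rw [this]; exact hf }
  have hmem : expNegExt ∈ A := Algebra.subset_adjoin (mem_singleton _)
  refine ext_of_forall_mem_subalgebra_integral_eq_of_polish (A := A) ?_ ?_
  · intro x y hxy
    refine ⟨expNegExt, ⟨expNegExt.toContinuousMap, ⟨expNegExt, hmem, rfl⟩, rfl⟩, ?_⟩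
    exact expNegExt_strictAnti.injective.ne hxy
  · intro g hg
    have hg' : g ∈ Algebra.adjoin ℝ {expNegExt} := hg
    rw [Algebra.adjoin_singleton_eq_range_aeval] at hg'
    obtain ⟨p, rfl⟩ := hg'
    induction p using Polynomial.induction_on' with
    | add p q hp hq =>
      have hp' := hp (by
        change _ ∈ Algebra.adjoin ℝ {expNegExt}
        rw [Algebra.adjoin_singleton_eq_range_aeval]; exact ⟨p, rfl⟩)
      have hq' := hq (by
        change _ ∈ Algebra.adjoin ℝ {expNegExt}
        rw [Algebra.adjoin_singleton_eq_range_aeval]; exact ⟨q, rfl⟩)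
      simp only [map_add, BoundedContinuousFunction.coe_add, Pi.add_apply]
      rw [integral_add (BoundedContinuousFunction.integrable _ _)
          (BoundedContinuousFunction.integrable _ _),
        integral_add (BoundedContinuousFunction.integrable _ _)
          (BoundedContinuousFunction.integrable _ _), hp', hq']
    | monomial n a =>
      have : ∀ t, (Polynomial.aeval expNegExt (Polynomial.monomial n a)) t
          = a * expNegExt t ^ n := by
        intro t
        simp [Polynomial.aeval_monomial, Algebra.algebraMap_eq_smul_one]
      change ∫ t, (Polynomial.aeval expNegExt (Polynomial.monomial n a)) t ∂P =
        ∫ t, (Polynomial.aeval expNegExt (Polynomial.monomial n a)) t ∂Q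
      simp only [this, integral_const_mul, h n]

/-- The positive and negative parts of `u` are densities of two finite measures. The hypothesis says
that these have the same moments of `exp (-t)`, so the measures, and hence the densities, agree. -/
lemma ae_eq_zero_of_integral_exp_neg_nat_mul {u : ℝ → ℝ} (hu : IntegrableOn u (Ioi 0))
    (h : ∀ n : ℕ, ∫ t in Ioi (0 : ℝ), Real.exp (-(n * t)) * u t = 0) :
    u =ᵐ[volume.restrict (Ioi 0)] 0 := by
  have hup : AEMeasurable (fun t => ENNReal.ofReal (u t)) (volume.restrict (Ioi (0 : ℝ))) :=
    hu.aemeasurable.ennreal_ofReal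
  have hun : AEMeasurable (fun t => ENNReal.ofReal (-u t)) (volume.restrict (Ioi (0 : ℝ))) :=
    hu.neg.aemeasurable.ennreal_ofReal
  have hpf : ∫⁻ t in Ioi 0, ENNReal.ofReal (u t) ≠ ∞ := hu.lintegral_lt_top.ne
  have hnf : ∫⁻ t in Ioi 0, ENNReal.ofReal (-u t) ≠ ∞ := hu.neg.lintegral_lt_top.ne
  have : IsFiniteMeasure ((volume.restrict (Ioi (0 : ℝ))).withDensity
    fun t => ENNReal.ofReal (u t)) := isFiniteMeasure_withDensity hpf
  have : IsFiniteMeasure ((volume.restrict (Ioi (0 : ℝ))).withDensity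
    fun t => ENNReal.ofReal (-u t)) := isFiniteMeasure_withDensity hnf
  have heq : (volume.restrict (Ioi (0 : ℝ))).withDensity (fun t => ENNReal.ofReal (u t)) =
      (volume.restrict (Ioi (0 : ℝ))).withDensity (fun t => ENNReal.ofReal (-u t)) := by
    refine ext_of_integral_expNegExt_pow fun n => ?_
    rw [integral_withDensity_eq_integral_toReal_smul₀ hup
        (Eventually.of_forall fun _ => ENNReal.ofReal_lt_top),
      integral_withDensity_eq_integral_toReal_smul₀ hun
        (Eventually.of_forall fun _ => ENNReal.ofReal_lt_top), ← sub_eq_zero]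
    have hb : ∀ v : ℝ → ℝ, IntegrableOn v (Ioi 0) → IntegrableOn
        (fun t => (ENNReal.ofReal (v t)).toReal • expNegExt t ^ n) (Ioi 0) := by
      intro v hv
      simp only [ENNReal.toReal_ofReal', smul_eq_mul]
      refine Integrable.mul_bdd (c := ‖expNegExt‖ ^ n) hv.pos_part ?_ ?_
      · exact (expNegExt.continuous.pow n).aestronglyMeasurable
      · refine Eventually.of_forall fun t => ?_
        rw [norm_pow]
        exact pow_le_pow_left₀ (norm_nonneg _) (expNegExt.norm_coe_le_norm t) n
    rw [← integral_sub (hb u hu) (hb (fun t => -u t) hu.neg)]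
    refine Eq.trans (setIntegral_congr_fun measurableSet_Ioi fun t ht => ?_) (h n)
    simp only [ENNReal.toReal_ofReal', smul_eq_mul]
    rw [expNegExt_of_pos ht, ← Real.exp_nat_mul, ← sub_mul, mul_neg, mul_comm]
    congr 1
    rcases le_total 0 (u t) with h0 | h0
    · rw [max_eq_left h0, max_eq_right (by linarith)]; ring
    · rw [max_eq_right h0, max_eq_left (by linarith)]; ring
  have := (withDensity_eq_iff hup hun hpf).1 heq
  filter_upwards [this] with t ht
  simp only [Pi.zero_apply]
  rcases lt_trichotomy (u t) 0 with h0 | h0 | h0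
  · rw [ENNReal.ofReal_of_nonpos h0.le] at ht
    exact absurd ht (ENNReal.ofReal_pos.2 (by linarith)).ne
  · exact h0
  · rw [ENNReal.ofReal_of_nonpos (by linarith : -u t ≤ 0)] at ht
    exact absurd ht (ENNReal.ofReal_pos.2 h0).ne'

/-- Lerch's theorem. -/
theorem IsInverseLaplace.eqOn {g f₁ f₂ : ℝ → ℝ} (h₁ : IsInverseLaplace g f₁)
    (h₂ : IsInverseLaplace g f₂) : EqOn f₁ f₂ (Ioi 0) := by
  have hint : ∀ s > 0, IntegrableOn (fun t => Real.exp (-s * t) * (f₁ t - f₂ t)) (Ioi 0) ∧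
      ∫ t in Ioi (0 : ℝ), Real.exp (-s * t) * (f₁ t - f₂ t) = 0 := by
    intro s hs
    simp only [mul_sub]
    refine ⟨(h₁.2 s hs).1.sub (h₂.2 s hs).1, ?_⟩
    rw [integral_sub (h₁.2 s hs).1 (h₂.2 s hs).1, (h₁.2 s hs).2, (h₂.2 s hs).2, sub_self]
  -- The difference `f₁ - f₂` need not be integrable, so the factor `exp (-t)` is kept inside `u`;
  -- this shifts the transform parameter from `n` to `n + 1`.
  have h0 := ae_eq_zero_of_integral_exp_neg_nat_mul (hint 1 one_pos).1 (fun n => by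
    refine Eq.trans (integral_congr_ae (Eventually.of_forall fun t => ?_))
      (hint (n + 1) (by positivity)).2
    simp only
    rw [← mul_assoc, ← Real.exp_add]
    congr 2; ring)
  refine Measure.eqOn_open_of_ae_eq (μ := volume) ?_ isOpen_Ioi h₁.1 h₂.1
  filter_upwards [h0] with t ht
  have := (mul_eq_zero.1 ht).resolve_left (Real.exp_pos _).ne'
  linarith

lemma isInverseLaplace_inverseLaplace {g f : ℝ → ℝ} (h : IsInverseLaplace g f) :
    IsInverseLaplace g (inverseLaplace g) := by
  have hex : ∃ f, IsInverseLaplace g f := ⟨f, h⟩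
  rw [inverseLaplace, dif_pos hex]
  exact hex.choose_spec

end Lerch

/-! ### Laplace transform of a distribution function. -/

section DistributionFunction

variable {Ω : Type*} [MeasurableSpace Ω] {μ : Measure Ω} [IsProbabilityMeasure μ]

/-- The distribution function of a nonnegative random variable without atoms on `(0, ∞)` is the
inverse Laplace transform of its Laplace transform divided by `s`. -/
lemma isInverseLaplace_distributionFunction {Z : Ω → ℝ} (hZ : AEMeasurable Z μ)
    (hZ0 : ∀ᵐ ω ∂μ, 0 ≤ Z ω)
    (hatom : ∀ t > 0, μ {ω | Z ω = t} = 0) {L : ℝ → ℝ} (hL0 : ∀ s > 0, 0 ≤ L s)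
    (hL : ∀ s > 0, ∫⁻ ω, ENNReal.ofReal (Real.exp (-(s * Z ω))) ∂μ = ENNReal.ofReal (L s)) :
    IsInverseLaplace (fun s => 1 / s * L s) (fun t => μ.real {ω | Z ω ≤ t}) := by
  have hprob : IsProbabilityMeasure (μ.map Z) := Measure.isProbabilityMeasure_map hZ
  have hcdf : (fun t => μ.real {ω | Z ω ≤ t}) = cdf (μ.map Z) := by
    ext t
    rw [cdf_eq_real, map_measureReal_apply_of_aemeasurable hZ measurableSet_Iic]
    rfl
  rw [hcdf]
  refine ⟨fun t ht => ContinuousAt.continuousWithinAt ?_, fun s hs => ?_⟩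
  -- The jump of the distribution function at `t` is the mass of the atom there.
  · have h1 : (cdf (μ.map Z)).measure {t} = 0 := by
      rw [measure_cdf, Measure.map_apply_of_aemeasurable hZ (measurableSet_singleton t)]
      exact hatom t ht
    rw [StieltjesFunction.measure_singleton, ENNReal.ofReal_eq_zero, sub_nonpos] at h1
    rw [(monotone_cdf _).continuousAt_iff_leftLim_eq_rightLim, StieltjesFunction.rightLim_eq]
    exact le_antisymm ((monotone_cdf _).leftLim_le le_rfl) h1
  · have hexp := integrableOn_exp_mul_Ioi (neg_neg_of_pos hs) 0
    have hmeas : Measurable (cdf (μ.map Z)) := (monotone_cdf _).measurable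
    have hint : IntegrableOn (fun t => Real.exp (-s * t) * cdf (μ.map Z) t) (Ioi 0) := by
      refine Integrable.mul_bdd (c := 1) hexp hmeas.aestronglyMeasurable ?_
      refine Eventually.of_forall fun t => ?_
      rw [Real.norm_eq_abs, abs_of_nonneg (cdf_nonneg _ _)]
      exact cdf_le_one _ _
    refine ⟨hint, ?_⟩
    rw [integral_eq_lintegral_of_nonneg_ae
      (Eventually.of_forall fun t => mul_nonneg (Real.exp_pos _).le (cdf_nonneg _ _))
      hint.aestronglyMeasurable]
    have hmap : ∫⁻ x, ENNReal.ofReal (Real.exp (-(s * x))) ∂(μ.map Z) = ENNReal.ofReal (L s) := by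
      rw [lintegral_map' (by fun_prop) hZ, hL s hs]
    have hpos : ∀ᵐ x ∂(μ.map Z), 0 ≤ x := (ae_map_iff hZ measurableSet_Ici).2 hZ0
    have hprod : Measurable fun p : ℝ × ℝ => (Iic p.1).indicator
        (fun _ => ENNReal.ofReal (Real.exp (-s * p.1))) p.2 := by
      have : (fun p : ℝ × ℝ => (Iic p.1).indicator
        (fun _ => ENNReal.ofReal (Real.exp (-s * p.1))) p.2) =
        {p : ℝ × ℝ | p.2 ≤ p.1}.indicator fun p => ENNReal.ofReal (Real.exp (-s * p.1)) := by
        ext p; simp [indicator]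
      rw [this]
      exact Measurable.indicator (by fun_prop) (measurableSet_le measurable_snd measurable_fst)
    have hkey : ∫⁻ t in Ioi (0 : ℝ), ENNReal.ofReal (Real.exp (-s * t) * cdf (μ.map Z) t) =
        ENNReal.ofReal (1 / s * L s) := by
      -- Write the distribution function as the integral of the indicator of `x ≤ t`, swap, and use
      -- `∫_x^∞ exp (-s t) dt = exp (-s x) / s` for `x ≥ 0`.
      calc ∫⁻ t in Ioi (0 : ℝ), ENNReal.ofReal (Real.exp (-s * t) * cdf (μ.map Z) t)
          = ∫⁻ t in Ioi (0 : ℝ), ∫⁻ x, (Iic t).indicator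
              (fun _ => ENNReal.ofReal (Real.exp (-s * t))) x ∂(μ.map Z) := by
            refine lintegral_congr fun t => ?_
            rw [lintegral_indicator measurableSet_Iic, setLIntegral_const,
              ENNReal.ofReal_mul (Real.exp_pos _).le, ofReal_cdf]
        _ = ∫⁻ x, (∫⁻ t in Ioi (0 : ℝ), (Iic t).indicator
              (fun _ => ENNReal.ofReal (Real.exp (-s * t))) x) ∂(μ.map Z) :=
            lintegral_lintegral_swap hprod.aemeasurable
        _ = ∫⁻ x, ENNReal.ofReal (1 / s) * ENNReal.ofReal (Real.exp (-(s * x))) ∂(μ.map Z) := by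
            refine lintegral_congr_ae ?_
            filter_upwards [hpos] with x hx
            have h1 : ∀ t, (Iic t).indicator (fun _ => ENNReal.ofReal (Real.exp (-s * t))) x =
                (Ici x).indicator (fun t => ENNReal.ofReal (Real.exp (-s * t))) t := by
              intro t; simp [indicator]
            simp only [h1]
            rw [lintegral_indicator measurableSet_Ici, Measure.restrict_restrict measurableSet_Ici]
            have h2 : (Ici x ∩ Ioi (0 : ℝ) : Set ℝ) =ᵐ[volume] Ioi x := by
              have h3 : (Ici x ∩ Ioi (0 : ℝ) : Set ℝ) =ᵐ[volume] (Ioi x ∩ Ioi (0 : ℝ) : Set ℝ) :=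
                Ioi_ae_eq_Ici.symm.inter (ae_eq_refl _)
              rwa [inter_eq_left.2 (Ioi_subset_Ioi hx)] at h3
            rw [setLIntegral_congr h2, ← ofReal_integral_eq_lintegral_ofReal
              (integrableOn_exp_mul_Ioi (neg_neg_of_pos hs) x)
              (Eventually.of_forall fun t => (Real.exp_pos _).le),
              integral_exp_mul_Ioi (neg_neg_of_pos hs), ← ENNReal.ofReal_mul (by positivity)]
            congr 1
            rw [neg_mul]; field_simp
        _ = ENNReal.ofReal (1 / s * L s) := by
            rw [lintegral_const_mul' _ _ ENNReal.ofReal_ne_top, hmap,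
              ENNReal.ofReal_mul (by positivity)]
    rw [hkey, ENNReal.toReal_ofReal (mul_nonneg (by positivity) (hL0 s hs))]

end DistributionFunction

/-! ### Infinite products of exponentials and almost sure convergence. -/

section LaplaceFunctional

lemma iInf_prod_exp_neg {y : ℕ → ℝ} (hy : ∀ i, 0 ≤ y i) (h : Summable y) :
    ⨅ n, ∏ i ∈ Finset.range n, ENNReal.ofReal (Real.exp (-y i))
      = ENNReal.ofReal (Real.exp (-∑' i, y i)) := by
  have h1 : ∀ n, ∏ i ∈ Finset.range n, ENNReal.ofReal (Real.exp (-y i)) =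
      ENNReal.ofReal (Real.exp (-∑ i ∈ Finset.range n, y i)) := fun n => by
    rw [← ENNReal.ofReal_prod_of_nonneg (fun _ _ => (Real.exp_pos _).le), ← Real.exp_sum,
      Finset.sum_neg_distrib]
  refine tendsto_nhds_unique (tendsto_atTop_iInf (antitone_prod_range fun i => ?_)) ?_
  · exact ENNReal.ofReal_le_one.2 (Real.exp_le_one_iff.2 (by linarith [hy i]))
  · simp only [h1]
    exact ENNReal.tendsto_ofReal ((Real.continuous_exp.tendsto _).comp
      h.hasSum.tendsto_sum_nat.neg)

/-- On divergent series the infimum of products takes the correct value `exp (-∞) = 0`, whereas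
`tsum` would be 0 and its exponential 1. -/
lemma iInf_prod_exp_neg_of_not_summable {y : ℕ → ℝ} (hy : ∀ i, 0 ≤ y i) (h : ¬ Summable y) :
    ⨅ n, ∏ i ∈ Finset.range n, ENNReal.ofReal (Real.exp (-y i)) = 0 := by
  have h1 : ∀ n, ∏ i ∈ Finset.range n, ENNReal.ofReal (Real.exp (-y i)) =
      ENNReal.ofReal (Real.exp (-∑ i ∈ Finset.range n, y i)) := fun n => by
    rw [← ENNReal.ofReal_prod_of_nonneg (fun _ _ => (Real.exp_pos _).le), ← Real.exp_sum,
      Finset.sum_neg_distrib]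
  refine tendsto_nhds_unique (tendsto_atTop_iInf (antitone_prod_range fun i => ?_)) ?_
  · exact ENNReal.ofReal_le_one.2 (Real.exp_le_one_iff.2 (by linarith [hy i]))
  · simp only [h1]
    rw [← ENNReal.ofReal_zero]
    refine ENNReal.tendsto_ofReal (Real.tendsto_exp_neg_atTop_nhds_zero.comp ?_)
    exact (not_summable_iff_tendsto_nat_atTop_of_nonneg hy).1 h

variable {Ω : Type*} [MeasurableSpace Ω] {μ : Measure Ω} [IsProbabilityMeasure μ]

/-- A series of nonnegative random variables converges almost surely if its Laplace transform
tends to `1` at zero. -/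
lemma ae_summable_of_laplace {y : ℕ → Ω → ℝ} (hy : ∀ i, Measurable (y i))
    (hy0 : ∀ᵐ ω ∂μ, ∀ i, 0 ≤ y i ω) {K : ℝ → ℝ} (hK : Tendsto K (𝓝[>] 0) (𝓝 0))
    (hL : ∀ s > 0, ∫⁻ ω, ⨅ n, ∏ i ∈ Finset.range n, ENNReal.ofReal (Real.exp (-(s * y i ω))) ∂μ
      = ENNReal.ofReal (Real.exp (-K s))) :
    ∀ᵐ ω ∂μ, Summable fun i => y i ω := by
  have hm : MeasurableSet {ω | ∑' i, ENNReal.ofReal (y i ω) ≠ ∞} :=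
    (Measurable.tsum fun i => (hy i).ennreal_ofReal) (measurableSet_singleton ∞).compl
  have hiff : ∀ ω, (∀ i, 0 ≤ y i ω) → ¬ (Summable fun i => y i ω) →
      ∑' i, ENNReal.ofReal (y i ω) = ∞ := by
    intro ω h1 h2
    by_contra h3
    refine h2 ?_
    have := ENNReal.summable_toReal h3
    simpa [ENNReal.toReal_ofReal (h1 _)] using this
  -- The infimum of products is at most the indicator of convergence, so its mean bounds the
  -- probability of convergence from below; then `s ↓ 0`.
  have hle : ∀ s > 0, ENNReal.ofReal (Real.exp (-K s)) ≤
      μ {ω | ∑' i, ENNReal.ofReal (y i ω) ≠ ∞} := by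
    intro s hs
    rw [← hL s hs, ← lintegral_indicator_one hm]
    refine lintegral_mono_ae ?_
    filter_upwards [hy0] with ω hω
    by_cases hf : ∑' i, ENNReal.ofReal (y i ω) = ∞
    · rw [iInf_prod_exp_neg_of_not_summable (fun i => mul_nonneg hs.le (hω i))]
      · exact zero_le
      · rw [summable_mul_left_iff hs.ne']
        intro h
        have := ENNReal.ofReal_tsum_of_nonneg hω h
        rw [hf] at this
        exact ENNReal.ofReal_ne_top this
    · have : ω ∈ {ω | ∑' i, ENNReal.ofReal (y i ω) ≠ ∞} := hf
      rw [indicator_of_mem this]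
      exact (iInf_le _ 0).trans (by simp)
  have h1 : 1 ≤ μ {ω | ∑' i, ENNReal.ofReal (y i ω) ≠ ∞} := by
    have hlim : Tendsto (fun s => ENNReal.ofReal (Real.exp (-K s))) (𝓝[>] 0) (𝓝 1) := by
      have := ENNReal.tendsto_ofReal ((Real.continuous_exp.tendsto _).comp hK.neg)
      simpa using this
    refine le_of_tendsto hlim ?_
    filter_upwards [self_mem_nhdsWithin] with s hs using hle s hs
  have h2 : ∀ᵐ ω ∂μ, ∑' i, ENNReal.ofReal (y i ω) ≠ ∞ :=
    (prob_compl_eq_zero_iff hm).2 (le_antisymm prob_le_one h1)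
  filter_upwards [h2, hy0] with ω hω1 hω2
  by_contra h
  exact hω1 (hiff ω hω2 h)

end LaplaceFunctional

end CellFree

namespace CellFree

/-! ### Laplace transform of a single link. -/

section LinkTransform

/-- The Laplace transform at `a` of a gamma variable of shape `N` and unit mean. -/
noncomputable def gammaTransform (N : ℕ) (a : ℝ) : ℝ := (1 + a / N) ^ (-(N : ℤ))

lemma gammaTransform_eq (N : ℕ) (a : ℝ) : gammaTransform N a = ((1 + a / N) ^ N)⁻¹ := by
  rw [gammaTransform, zpow_neg, zpow_natCast]

lemma gammaTransform_nonneg (N : ℕ) {a : ℝ} (ha : 0 ≤ a) : 0 ≤ gammaTransform N a := by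
  rw [gammaTransform_eq]; positivity

lemma gammaTransform_le_one (N : ℕ) {a : ℝ} (ha : 0 ≤ a) : gammaTransform N a ≤ 1 := by
  rw [gammaTransform_eq]
  exact inv_le_one_of_one_le₀ (one_le_pow₀ (by have : 0 ≤ a / N := by positivity
                                               linarith))

/-- From `(1 + a / N) ^ N ≤ exp a` and `1 - exp (-a) ≤ a`. For `N = 0` the transform is identically
1. -/
lemma one_sub_gammaTransform_le (N : ℕ) {a : ℝ} (ha : 0 ≤ a) : 1 - gammaTransform N a ≤ a := by
  rcases Nat.eq_zero_or_pos N with rfl | hN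
  · simp [gammaTransform, ha]
  have hN' : (0 : ℝ) < N := by exact_mod_cast hN
  rw [gammaTransform_eq]
  have h1 : (1 + a / N) ^ N ≤ Real.exp a := by
    calc (1 + a / N) ^ N ≤ Real.exp (a / N) ^ N :=
          pow_le_pow_left₀ (by positivity) (by linarith [Real.add_one_le_exp (a / N)]) N
      _ = Real.exp a := by rw [← Real.exp_nat_mul]; congr 1; field_simp
  have h2 : Real.exp (-a) ≤ ((1 + a / N) ^ N)⁻¹ := by
    rw [Real.exp_neg]
    exact inv_anti₀ (by positivity) h1
  linarith [Real.add_one_le_exp (-a)]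

lemma measurable_gammaTransform (N : ℕ) : Measurable (gammaTransform N) := by
  have : gammaTransform N = fun a : ℝ => ((1 + a / N) ^ N)⁻¹ := funext (gammaTransform_eq N)
  rw [this]; fun_prop

variable {c₁ c₂ : ℝ}

lemma losProb_nonneg (hc₂ : 0 < c₂) (θ : ℝ) : 0 ≤ losProb c₁ c₂ θ := by
  unfold losProb; positivity

lemma losProb_le_one (hc₂ : 0 < c₂) (θ : ℝ) : losProb c₁ c₂ θ ≤ 1 := by
  unfold losProb
  rw [div_le_one (by positivity)]
  have : 0 < c₂ * Real.exp (-c₁ * θ) := by positivity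
  linarith

lemma measurable_losProb : Measurable (losProb c₁ c₂) := by
  unfold losProb; fun_prop

/-- The Laplace transform at `s` of the signal of a node at horizontal distance `r` and
altitude `h`, for gains of unit mean. -/
noncomputable def linkTransform (c₁ c₂ α ℓ : ℝ) (N : ℕ) (s r h : ℝ) : ℝ :=
  losProb c₁ c₂ (Real.arctan (h / r)) * gammaTransform N (s * (r ^ 2 + h ^ 2) ^ (-(α / 2)))
    + (1 - losProb c₁ c₂ (Real.arctan (h / r))) *
      gammaTransform N (s * (r ^ 2 + h ^ 2) ^ (-(α / 2)) * ℓ)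

variable {α ℓ : ℝ} {N : ℕ} {s r h : ℝ}

lemma convexComb_le {p a b M : ℝ} (hp0 : 0 ≤ p) (hp1 : p ≤ 1) (ha : a ≤ M) (hb : b ≤ M) :
    p * a + (1 - p) * b ≤ M := by
  nlinarith [mul_le_mul_of_nonneg_left ha hp0, mul_le_mul_of_nonneg_left hb (sub_nonneg.2 hp1)]

lemma le_convexComb {p a b M : ℝ} (hp0 : 0 ≤ p) (hp1 : p ≤ 1) (ha : M ≤ a) (hb : M ≤ b) :
    M ≤ p * a + (1 - p) * b := by
  nlinarith [mul_le_mul_of_nonneg_left ha hp0, mul_le_mul_of_nonneg_left hb (sub_nonneg.2 hp1)]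

lemma linkTransform_nonneg (hc₂ : 0 < c₂) (hℓ : 0 ≤ ℓ) (hs : 0 ≤ s) :
    0 ≤ linkTransform c₁ c₂ α ℓ N s r h :=
  le_convexComb (losProb_nonneg hc₂ _) (losProb_le_one hc₂ _)
    (gammaTransform_nonneg _ (by positivity)) (gammaTransform_nonneg _ (by positivity))

lemma linkTransform_le_one (hc₂ : 0 < c₂) (hℓ : 0 ≤ ℓ) (hs : 0 ≤ s) :
    linkTransform c₁ c₂ α ℓ N s r h ≤ 1 :=
  convexComb_le (losProb_nonneg hc₂ _) (losProb_le_one hc₂ _)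
    (gammaTransform_le_one _ (by positivity)) (gammaTransform_le_one _ (by positivity))

/-- Altitude only increases the distance and `ℓ ≤ 1` only weakens the signal, so a line-of-sight
node on the ground is the worst case. The bound is free of `h`, so no moment of the altitude is
required. -/
lemma one_sub_linkTransform_le (hc₂ : 0 < c₂) (hα : 0 < α) (hℓ : ℓ ∈ Icc (0 : ℝ) 1) (hs : 0 ≤ s)
    (hr : 0 < r) :
    1 - linkTransform c₁ c₂ α ℓ N s r h ≤ s * (r ^ 2) ^ (-(α / 2)) := by
  have hle : s * (r ^ 2 + h ^ 2) ^ (-(α / 2)) ≤ s * (r ^ 2) ^ (-(α / 2)) :=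
    mul_le_mul_of_nonneg_left
      (Real.rpow_le_rpow_of_nonpos (by positivity) (by linarith [sq_nonneg h]) (by linarith)) hs
  have h0 : 0 ≤ s * (r ^ 2 + h ^ 2) ^ (-(α / 2)) := by positivity
  have h1 := one_sub_gammaTransform_le N h0
  have h2 := one_sub_gammaTransform_le N (mul_nonneg h0 hℓ.1)
  have h3 := mul_le_of_le_one_right h0 hℓ.2
  have := le_convexComb (M := 1 - s * (r ^ 2) ^ (-(α / 2)))
    (a := gammaTransform N (s * (r ^ 2 + h ^ 2) ^ (-(α / 2))))
    (b := gammaTransform N (s * (r ^ 2 + h ^ 2) ^ (-(α / 2)) * ℓ))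
    (losProb_nonneg hc₂ (Real.arctan (h / r)) (c₁ := c₁)) (losProb_le_one hc₂ _)
    (by linarith) (by linarith)
  unfold linkTransform
  linarith

lemma measurable_linkTransform (c₁ c₂ α ℓ : ℝ) (N : ℕ) (s : ℝ) :
    Measurable (Function.uncurry (linkTransform c₁ c₂ α ℓ N s)) := by
  have h1 : Measurable fun p : ℝ × ℝ => losProb c₁ c₂ (Real.arctan (p.2 / p.1)) :=
    measurable_losProb.comp (Real.measurable_arctan.comp (by fun_prop))
  have h2 : Measurable fun p : ℝ × ℝ => s * (p.1 ^ 2 + p.2 ^ 2) ^ (-(α / 2)) := by fun_prop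
  have h3 := (measurable_gammaTransform N).comp h2
  have h4 := (measurable_gammaTransform N).comp (h2.mul_const ℓ)
  exact (h1.mul h3).add ((h1.const_sub 1).mul h4)

/-- One minus the Laplace transform at `s` of the signal of a node at horizontal distance `r`
with random altitude. -/
noncomputable def defect (c₁ c₂ α ℓ : ℝ) (N : ℕ) (η : Measure ℝ) (s r : ℝ) : ℝ :=
  1 - ∫ h, linkTransform c₁ c₂ α ℓ N s r h ∂η

variable {η : Measure ℝ}

lemma measurable_defect [SFinite η] : Measurable (defect c₁ c₂ α ℓ N η s) := by
  unfold defect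
  refine Measurable.const_sub ?_ 1
  exact (measurable_linkTransform c₁ c₂ α ℓ N s).stronglyMeasurable.integral_prod_right.measurable

lemma defect_le_one (hc₂ : 0 < c₂) (hℓ : 0 ≤ ℓ) (hs : 0 ≤ s) :
    defect c₁ c₂ α ℓ N η s r ≤ 1 := by
  have : 0 ≤ ∫ h, linkTransform c₁ c₂ α ℓ N s r h ∂η :=
    integral_nonneg fun h => linkTransform_nonneg hc₂ hℓ hs
  unfold defect; linarith

/-- With `cos (arctan (h / √z)) ^ 2 = z / (z + h ^ 2)`, the product `z ^ (-α / 2) cos ^ α` is the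
path loss `(z + h ^ 2) ^ (-α / 2)` at horizontal distance `√z`. -/
lemma JG_eq_defect {z : ℝ} (hz : 0 < z) (c₁ c₂ α ℓ : ℝ) (N : ℕ) (s : ℝ) :
    JG c₁ c₂ α ℓ N (s * z ^ (-(α / 2))) (angleLaw η z) = defect c₁ c₂ α ℓ N η s √z := by
  have hmeas : Measurable fun h : ℝ => Real.arctan (h / √z) :=
    Real.measurable_arctan.comp (by fun_prop)
  have hcos : ∀ h : ℝ, z ^ (-(α / 2)) * Real.cos (Real.arctan (h / √z)) ^ α =
      (√z ^ 2 + h ^ 2) ^ (-(α / 2)) := by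
    intro h
    have h1 : 1 + (h / √z) ^ 2 = (z + h ^ 2) / z := by
      rw [div_pow, Real.sq_sqrt hz.le]; field_simp
    rw [Real.cos_arctan, h1, Real.sq_sqrt hz.le, one_div, Real.inv_rpow (by positivity),
      Real.sqrt_eq_rpow, ← Real.rpow_mul (by positivity), show 1 / 2 * α = α / 2 by ring,
      Real.div_rpow (by positivity) hz.le, Real.rpow_neg hz.le, Real.rpow_neg (by positivity)]
    have h2 := (Real.rpow_pos_of_pos hz (α / 2)).ne'
    have h3 := (Real.rpow_pos_of_pos (by positivity : 0 < z + h ^ 2) (α / 2)).ne'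
    field_simp
  have hF : Measurable fun y => losProb c₁ c₂ y *
        gammaTransform N (s * z ^ (-(α / 2)) * Real.cos y ^ α)
      + (1 - losProb c₁ c₂ y) *
        gammaTransform N (s * z ^ (-(α / 2)) * Real.cos y ^ α * ℓ) := by
    have h2 : Measurable fun y : ℝ => s * z ^ (-(α / 2)) * Real.cos y ^ α := by fun_prop
    have h3 := (measurable_gammaTransform N).comp h2
    have h4 := (measurable_gammaTransform N).comp (h2.mul_const ℓ)
    exact (measurable_losProb.mul h3).add ((measurable_losProb.const_sub 1).mul h4)
  have hJ : JG c₁ c₂ α ℓ N (s * z ^ (-(α / 2))) (angleLaw η z) = 1 - ∫ y, (losProb c₁ c₂ y *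
        gammaTransform N (s * z ^ (-(α / 2)) * Real.cos y ^ α)
      + (1 - losProb c₁ c₂ y) *
        gammaTransform N (s * z ^ (-(α / 2)) * Real.cos y ^ α * ℓ)) ∂(angleLaw η z) := rfl
  rw [hJ, angleLaw, integral_map hmeas.aemeasurable hF.aestronglyMeasurable, defect]
  congr 1
  refine integral_congr_ae (Eventually.of_forall fun h => ?_)
  simp only [linkTransform, mul_assoc s, hcos]

variable [IsProbabilityMeasure η]

lemma integrable_linkTransform (hc₂ : 0 < c₂) (hℓ : 0 ≤ ℓ) (hs : 0 ≤ s) :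
    Integrable (fun h => linkTransform c₁ c₂ α ℓ N s r h) η := by
  refine Integrable.of_bound (C := 1) ?_ (Eventually.of_forall fun h => ?_)
  · exact ((measurable_linkTransform c₁ c₂ α ℓ N s).comp
      measurable_prodMk_left).aestronglyMeasurable
  · rw [Real.norm_eq_abs, abs_of_nonneg (linkTransform_nonneg hc₂ hℓ hs)]
    exact linkTransform_le_one hc₂ hℓ hs

lemma defect_eq_integral (hc₂ : 0 < c₂) (hℓ : 0 ≤ ℓ) (hs : 0 ≤ s) :
    defect c₁ c₂ α ℓ N η s r = ∫ h, (1 - linkTransform c₁ c₂ α ℓ N s r h) ∂η := by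
  rw [integral_sub (integrable_const _) (integrable_linkTransform hc₂ hℓ hs)]
  simp [defect]

lemma defect_nonneg (hc₂ : 0 < c₂) (hℓ : 0 ≤ ℓ) (hs : 0 ≤ s) :
    0 ≤ defect c₁ c₂ α ℓ N η s r := by
  rw [defect_eq_integral hc₂ hℓ hs]
  exact integral_nonneg fun h => sub_nonneg.2 (linkTransform_le_one hc₂ hℓ hs)

lemma defect_le (hc₂ : 0 < c₂) (hα : 0 < α) (hℓ : ℓ ∈ Icc (0 : ℝ) 1) (hs : 0 ≤ s) (hr : 0 < r) :
    defect c₁ c₂ α ℓ N η s r ≤ s * (r ^ 2) ^ (-(α / 2)) := by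
  rw [defect_eq_integral hc₂ hℓ.1 hs]
  calc _ ≤ ∫ _, s * (r ^ 2) ^ (-(α / 2)) ∂η :=
        integral_mono ((integrable_const _).sub (integrable_linkTransform hc₂ hℓ.1 hs))
          (integrable_const _) fun h => one_sub_linkTransform_le hc₂ hα hℓ hs hr
    _ = _ := by simp

lemma ofReal_defect (hc₂ : 0 < c₂) (hℓ : 0 ≤ ℓ) (hs : 0 ≤ s) :
    1 - ENNReal.ofReal (defect c₁ c₂ α ℓ N η s r) =
      ∫⁻ h, ENNReal.ofReal (linkTransform c₁ c₂ α ℓ N s r h) ∂η := by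
  rw [← ofReal_integral_eq_lintegral_ofReal (integrable_linkTransform hc₂ hℓ hs)
    (Eventually.of_forall fun h => linkTransform_nonneg hc₂ hℓ hs), ← ENNReal.ofReal_one,
    ← ENNReal.ofReal_sub _ (defect_nonneg hc₂ hℓ hs)]
  congr 1
  unfold defect; ring

end LinkTransform

/-! ### Integrability, polar coordinates and limits. -/

section Integrals

variable {c₁ c₂ α ℓ s : ℝ} {N : ℕ} {η : Measure ℝ} [IsProbabilityMeasure η]

/-- The majorant for `defect`: the constant controls it near 0, and the power, with exponent `-α / 2
< -1`, at infinity. -/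
lemma integrableOn_min_one_rpow (hα : 2 < α) :
    IntegrableOn (fun z : ℝ => min 1 (z ^ (-(α / 2)))) (Ioi 0) := by
  have hm : Measurable fun z : ℝ => min 1 (z ^ (-(α / 2))) := by fun_prop
  rw [← Ioc_union_Ioi_eq_Ioi zero_le_one]
  refine IntegrableOn.union ?_ ?_
  · refine Integrable.mono' (integrable_const (1 : ℝ)) hm.aestronglyMeasurable ?_
    refine ae_restrict_of_forall_mem measurableSet_Ioc fun z hz => ?_
    rw [Real.norm_eq_abs, abs_of_nonneg (le_min zero_le_one (Real.rpow_nonneg hz.1.le _))]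
    exact min_le_left _ _
  · refine Integrable.mono' (integrableOn_Ioi_rpow_of_lt (a := -(α / 2)) (by linarith) one_pos)
      hm.aestronglyMeasurable ?_
    refine ae_restrict_of_forall_mem measurableSet_Ioi fun z (hz : 1 < z) => ?_
    rw [Real.norm_eq_abs, abs_of_nonneg (le_min zero_le_one (Real.rpow_nonneg (by linarith) _))]
    exact min_le_right _ _

lemma defect_sqrt_le (hc₂ : 0 < c₂) (hα : 0 < α) (hℓ : ℓ ∈ Icc (0 : ℝ) 1) (hs : 0 ≤ s) {z : ℝ}
    (hz : 0 < z) : defect c₁ c₂ α ℓ N η s √z ≤ s * z ^ (-(α / 2)) := by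
  have := defect_le (c₁ := c₁) (N := N) (η := η) hc₂ hα hℓ hs (Real.sqrt_pos.2 hz)
  rwa [Real.sq_sqrt hz.le] at this

lemma norm_defect_sqrt_le (hc₂ : 0 < c₂) (hα : 0 < α) (hℓ : ℓ ∈ Icc (0 : ℝ) 1) (hs : 0 ≤ s)
    {M : ℝ} (hM : 1 ≤ M) (hsM : s ≤ M) {z : ℝ} (hz : 0 < z) :
    ‖defect c₁ c₂ α ℓ N η s √z‖ ≤ M * min 1 (z ^ (-(α / 2))) := by
  rw [Real.norm_eq_abs, abs_of_nonneg (defect_nonneg hc₂ hℓ.1 hs),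
    mul_min_of_nonneg _ _ (by linarith)]
  refine le_min ?_ ?_
  · linarith [defect_le_one (c₁ := c₁) (α := α) (N := N) (η := η) (r := √z) hc₂ hℓ.1 hs]
  · exact (defect_sqrt_le hc₂ hα hℓ hs hz).trans
      (mul_le_mul_of_nonneg_right hsM (Real.rpow_nonneg hz.le _))

lemma integrableOn_defect_sqrt (hc₂ : 0 < c₂) (hα : 2 < α) (hℓ : ℓ ∈ Icc (0 : ℝ) 1)
    (hs : 0 ≤ s) : IntegrableOn (fun z => defect c₁ c₂ α ℓ N η s √z) (Ioi 0) := by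
  refine Integrable.mono' ((integrableOn_min_one_rpow hα).const_mul (max 1 s)) ?_ ?_
  · exact (measurable_defect.comp Real.continuous_sqrt.measurable).aestronglyMeasurable
  · exact ae_restrict_of_forall_mem measurableSet_Ioi fun z hz =>
      norm_defect_sqrt_le hc₂ (by linarith) hℓ hs (le_max_left _ _) (le_max_right _ _) hz

lemma tendsto_integral_defect_sqrt (hc₂ : 0 < c₂) (hα : 2 < α) (hℓ : ℓ ∈ Icc (0 : ℝ) 1) :
    Tendsto (fun s => ∫ z in Ioi (0 : ℝ), defect c₁ c₂ α ℓ N η s √z) (𝓝[>] 0) (𝓝 0) := by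
  suffices h : Tendsto (fun s => ∫ z in Ioi (0 : ℝ), defect c₁ c₂ α ℓ N η s √z) (𝓝[>] 0)
      (𝓝 (∫ _ in Ioi (0 : ℝ), (0 : ℝ))) by simpa using h
  refine tendsto_integral_filter_of_dominated_convergence
    (fun z => 1 * min 1 (z ^ (-(α / 2)))) ?_ ?_ ((integrableOn_min_one_rpow hα).const_mul 1) ?_
  · exact Eventually.of_forall fun s =>
      (measurable_defect.comp Real.continuous_sqrt.measurable).aestronglyMeasurable
  -- Restricting to `s < 1` makes the majorant independent of `s`.
  · filter_upwards [Ioo_mem_nhdsGT (zero_lt_one (α := ℝ))] with s hs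
    exact ae_restrict_of_forall_mem measurableSet_Ioi fun z hz =>
      norm_defect_sqrt_le hc₂ (by linarith) hℓ hs.1.le le_rfl hs.2.le hz
  · refine ae_restrict_of_forall_mem measurableSet_Ioi fun z hz => ?_
    have hlim : Tendsto (fun s : ℝ => s * z ^ (-(α / 2))) (𝓝[>] 0) (𝓝 0) := by
      have : Tendsto (fun s : ℝ => s * z ^ (-(α / 2))) (𝓝 0) (𝓝 (0 * z ^ (-(α / 2)))) :=
        tendsto_id.mul_const _
      rw [zero_mul] at this
      exact this.mono_left nhdsWithin_le_nhds
    refine squeeze_zero' ?_ ?_ hlim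
    · filter_upwards [self_mem_nhdsWithin] with s hs using defect_nonneg hc₂ hℓ.1 (le_of_lt hs)
    · filter_upwards [self_mem_nhdsWithin] with s hs using
        defect_sqrt_le hc₂ (by linarith) hℓ (le_of_lt hs) hz

/-- Polar coordinates in the plane, with the squared radius as variable. -/
lemma integral_plane_norm (f : ℝ → ℝ) :
    ∫ x : Plane, f ‖x‖ = Real.pi * ∫ z in Ioi (0 : ℝ), f √z := by
  -- The radial formula gives dimension times ball volume, `2 π ∫ y f y dy`; the substitution `z = y
  -- ^ 2` absorbs `2 y dy`.
  rw [integral_fun_norm_addHaar, ← integral_comp_rpow_Ioi_of_pos (g := fun z => f √z) two_pos]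
  have hv : (volume : Measure Plane).real (Metric.ball 0 1) = Real.pi := by
    rw [measureReal_def, EuclideanSpace.volume_ball_fin_two]
    simp [Real.pi_pos.le]
  rw [hv, finrank_euclideanSpace_fin, nsmul_eq_mul, smul_eq_mul, mul_left_comm]
  congr 1
  rw [← integral_const_mul]
  refine setIntegral_congr_fun measurableSet_Ioi fun y (hy : 0 < y) => ?_
  have h1 : √(y ^ (2 : ℝ)) = y := by
    rw [Real.rpow_two, Real.sqrt_sq hy.le]
  simp only [h1, smul_eq_mul]
  norm_num
  ring

lemma integrable_plane_norm {f : ℝ → ℝ} (hf : IntegrableOn (fun z => f √z) (Ioi 0)) :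
    Integrable fun x : Plane => f ‖x‖ := by
  rw [integrable_fun_norm_addHaar]
  have := (integrableOn_Ioi_comp_rpow_iff (fun z => f √z) (two_ne_zero (α := ℝ))).2 hf
  refine (IntegrableOn.congr_fun (this.const_mul (1 / 2)) (fun y (hy : 0 < y) => ?_)
    measurableSet_Ioi)
  have h1 : √(y ^ (2 : ℝ)) = y := by
    rw [Real.rpow_two, Real.sqrt_sq hy.le]
  simp only [h1, smul_eq_mul, finrank_euclideanSpace_fin]
  norm_num
  ring

lemma lintegral_defect (hc₂ : 0 < c₂) (hα : 2 < α) (hℓ : ℓ ∈ Icc (0 : ℝ) 1) (hs : 0 ≤ s)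
    {lam : ℝ} (hlam : 0 < lam) :
    ∫⁻ x, ENNReal.ofReal (defect c₁ c₂ α ℓ N η s ‖x‖)
        ∂(ENNReal.ofReal lam • (volume : Measure Plane))
      = ENNReal.ofReal (Real.pi * lam * ∫ z in Ioi (0 : ℝ), defect c₁ c₂ α ℓ N η s √z) := by
  rw [lintegral_smul_measure, ← ofReal_integral_eq_lintegral_ofReal
    (integrable_plane_norm (integrableOn_defect_sqrt hc₂ hα hℓ hs))
    (Eventually.of_forall fun x => defect_nonneg hc₂ hℓ.1 hs), integral_plane_norm, smul_eq_mul,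
    ← ENNReal.ofReal_mul hlam.le]
  congr 1; ring

lemma tendsto_gammaTransform {a : ℝ} :
    Tendsto (fun n => gammaTransform n a) atTop (𝓝 (Real.exp (-a))) := by
  simp only [gammaTransform_eq, Real.exp_neg]
  exact (Real.tendsto_one_add_div_pow_exp a).inv₀ (Real.exp_pos a).ne'

lemma tendsto_JG (hc₂ : 0 < c₂) (hℓ : ℓ ∈ Icc (0 : ℝ) 1) {x : ℝ} (hx : 0 ≤ x)
    (ν : Measure ℝ) [IsProbabilityMeasure ν] (hν : ∀ᵐ y ∂ν, y ∈ Icc 0 (Real.pi / 2)) :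
    Tendsto (fun n : ℕ => JG c₁ c₂ α ℓ n x ν) atTop
      (𝓝 (1 - ∫ y, (losProb c₁ c₂ y * Real.exp (-(x * Real.cos y ^ α))
        + (1 - losProb c₁ c₂ y) * Real.exp (-(x * ℓ * Real.cos y ^ α))) ∂ν)) := by
  refine Tendsto.const_sub 1 ?_
  change Tendsto (fun n : ℕ => ∫ y, (losProb c₁ c₂ y * gammaTransform n (x * Real.cos y ^ α)
    + (1 - losProb c₁ c₂ y) * gammaTransform n (x * Real.cos y ^ α * ℓ)) ∂ν) atTop _
  refine tendsto_integral_of_dominated_convergence (fun _ => 1) (fun n => ?_)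
    (integrable_const _) (fun n => ?_) (Eventually.of_forall fun y => ?_)
  · have h2 : Measurable fun y : ℝ => x * Real.cos y ^ α := by fun_prop
    have h3 := (measurable_gammaTransform n).comp h2
    have h4 := (measurable_gammaTransform n).comp (h2.mul_const ℓ)
    exact ((measurable_losProb.mul h3).add
      ((measurable_losProb.const_sub 1).mul h4)).aestronglyMeasurable
  · filter_upwards [hν] with y hy
    have hc : 0 ≤ Real.cos y ^ α :=
      Real.rpow_nonneg (Real.cos_nonneg_of_mem_Icc ⟨by linarith [hy.1, Real.pi_pos], hy.2⟩) _
    have ha : 0 ≤ x * Real.cos y ^ α := mul_nonneg hx hc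
    have hb : 0 ≤ x * Real.cos y ^ α * ℓ := mul_nonneg ha hℓ.1
    rw [Real.norm_eq_abs, abs_of_nonneg (le_convexComb (losProb_nonneg hc₂ _)
      (losProb_le_one hc₂ _) (gammaTransform_nonneg n ha) (gammaTransform_nonneg n hb))]
    exact convexComb_le (losProb_nonneg hc₂ _) (losProb_le_one hc₂ _)
      (gammaTransform_le_one n ha) (gammaTransform_le_one n hb)
  · rw [show x * ℓ * Real.cos y ^ α = x * Real.cos y ^ α * ℓ by ring]
    exact (tendsto_gammaTransform.const_mul _).add (tendsto_gammaTransform.const_mul _)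

end Integrals

end CellFree

namespace CellFree

/-! ### Averaging over conditionally independent link states. -/

section ConditionalMixing

variable {Ω : Type*} {m mΩ : MeasurableSpace Ω} {μ : Measure Ω} [IsProbabilityMeasure μ]

lemma norm_prod_le_one {ι : Type*} {S : Finset ι} {f : ι → ℝ} (h : ∀ i, |f i| ≤ 1) :
    ‖∏ i ∈ S, f i‖ ≤ 1 := by
  rw [norm_prod]
  exact Finset.prod_le_one (fun _ _ => norm_nonneg _) fun i _ => h i

/-- Replacing conditionally independent indicators by their conditional probabilities in a product
of mixtures. -/
lemma integral_prod_mixture (hm : m ≤ mΩ) {b ρ p q : ℕ → Ω → ℝ} (hb : ∀ i, Measurable (b i))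
    (hρ : ∀ i, Measurable (ρ i)) (hp : ∀ i, Measurable[m] (p i)) (hq : ∀ i, Measurable[m] (q i))
    (hb01 : ∀ i ω, b i ω ∈ Icc (0 : ℝ) 1) (hρ01 : ∀ i ω, ρ i ω ∈ Icc (0 : ℝ) 1)
    (hp01 : ∀ i ω, p i ω ∈ Icc (0 : ℝ) 1) (hq01 : ∀ i ω, q i ω ∈ Icc (0 : ℝ) 1)
    (hlaw : ∀ S : Finset ℕ, μ[fun ω => ∏ i ∈ S, b i ω | m] =ᵐ[μ] fun ω => ∏ i ∈ S, ρ i ω)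
    (n : ℕ) :
    ∫ ω, ∏ i ∈ Finset.range n, (b i ω * (p i ω - q i ω) + q i ω) ∂μ
      = ∫ ω, ∏ i ∈ Finset.range n, (ρ i ω * (p i ω - q i ω) + q i ω) ∂μ := by
  set M : Finset ℕ → Ω → ℝ := fun S ω =>
    (∏ i ∈ S, (p i ω - q i ω)) * ∏ i ∈ Finset.range n \ S, q i ω with hM
  have hMm : ∀ S, Measurable[m] (M S) := fun S =>
    (Finset.measurable_fun_prod _ fun i _ => (hp i).sub (hq i)).mul
      (Finset.measurable_fun_prod _ fun i _ => hq i)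
  have hMb : ∀ S ω, ‖M S ω‖ ≤ 1 := by
    intro S ω
    rw [hM, norm_mul]
    refine mul_le_one₀ (norm_prod_le_one fun i => ?_) (norm_nonneg _)
      (norm_prod_le_one fun i => ?_)
    · rw [abs_le]
      have := hp01 i ω
      have := hq01 i ω
      simp only [mem_Icc] at *
      constructor <;> linarith
    · rw [abs_le]
      have := hq01 i ω
      simp only [mem_Icc] at *
      constructor <;> linarith
  -- Expanding over subsets `S` separates an `m`-measurable bounded factor `M S` from `∏ i ∈ S, b
  -- i`, whose conditional expectation is prescribed by `hlaw`.
  have hexpand : ∀ (a : ℕ → Ω → ℝ) ω,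
      ∏ i ∈ Finset.range n, (a i ω * (p i ω - q i ω) + q i ω) =
        ∑ S ∈ (Finset.range n).powerset, M S ω * ∏ i ∈ S, a i ω := by
    intro a ω
    rw [Finset.prod_add]
    refine Finset.sum_congr rfl fun S _ => ?_
    rw [Finset.prod_mul_distrib, hM]
    ring
  have hint1 : ∀ (a : ℕ → Ω → ℝ), (∀ i, Measurable (a i)) → (∀ i ω, a i ω ∈ Icc (0 : ℝ) 1) →
      ∀ S, Integrable (fun ω => ∏ i ∈ S, a i ω) μ := by
    intro a ha ha01 S
    refine Integrable.of_bound (C := 1)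
      (Finset.measurable_fun_prod _ fun i _ => ha i).aestronglyMeasurable
      (Eventually.of_forall fun ω => norm_prod_le_one fun i => ?_)
    rw [abs_of_nonneg (ha01 i ω).1]
    exact (ha01 i ω).2
  have hint : ∀ (a : ℕ → Ω → ℝ), (∀ i, Measurable (a i)) → (∀ i ω, a i ω ∈ Icc (0 : ℝ) 1) →
      ∀ S, Integrable (fun ω => M S ω * ∏ i ∈ S, a i ω) μ := fun a ha ha01 S =>
    (hint1 a ha ha01 S).bdd_mul ((hMm S).mono hm le_rfl).aestronglyMeasurable
      (Eventually.of_forall (hMb S))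
  simp only [hexpand]
  rw [integral_finsetSum _ fun S _ => hint b hb hb01 S,
    integral_finsetSum _ fun S _ => hint ρ hρ hρ01 S]
  refine Finset.sum_congr rfl fun S _ => ?_
  rw [← integral_condExp hm]
  refine integral_congr_ae ?_
  have h1 := condExp_stronglyMeasurable_mul_of_bound hm (hMm S).stronglyMeasurable
    (hint1 b hb hb01 S) 1 (Eventually.of_forall (hMb S))
  filter_upwards [h1, hlaw S] with ω hω1 hω2
  refine hω1.trans ?_
  rw [Pi.mul_apply, hω2]

lemma lintegral_prod_mixture (hm : m ≤ mΩ) {b ρ p q : ℕ → Ω → ℝ} (hb : ∀ i, Measurable (b i))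
    (hρ : ∀ i, Measurable (ρ i)) (hp : ∀ i, Measurable[m] (p i)) (hq : ∀ i, Measurable[m] (q i))
    (hb01 : ∀ i ω, b i ω ∈ Icc (0 : ℝ) 1) (hρ01 : ∀ i ω, ρ i ω ∈ Icc (0 : ℝ) 1)
    (hp01 : ∀ i ω, p i ω ∈ Icc (0 : ℝ) 1) (hq01 : ∀ i ω, q i ω ∈ Icc (0 : ℝ) 1)
    (hlaw : ∀ S : Finset ℕ, μ[fun ω => ∏ i ∈ S, b i ω | m] =ᵐ[μ] fun ω => ∏ i ∈ S, ρ i ω)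
    (n : ℕ) :
    ∫⁻ ω, ∏ i ∈ Finset.range n, ENNReal.ofReal (b i ω * p i ω + (1 - b i ω) * q i ω) ∂μ
      = ∫⁻ ω, ∏ i ∈ Finset.range n, ENNReal.ofReal (ρ i ω * p i ω + (1 - ρ i ω) * q i ω) ∂μ := by
  have hconv : ∀ a : ℕ → Ω → ℝ, (∀ i, Measurable (a i)) → (∀ i ω, a i ω ∈ Icc (0 : ℝ) 1) →
      ∫⁻ ω, ∏ i ∈ Finset.range n, ENNReal.ofReal (a i ω * p i ω + (1 - a i ω) * q i ω) ∂μ =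
        ENNReal.ofReal (∫ ω, ∏ i ∈ Finset.range n, (a i ω * (p i ω - q i ω) + q i ω) ∂μ) := by
    intro a ha ha01
    have hr : ∀ i ω, a i ω * (p i ω - q i ω) + q i ω = a i ω * p i ω + (1 - a i ω) * q i ω :=
      fun i ω => by ring
    have h0 : ∀ i ω, 0 ≤ a i ω * p i ω + (1 - a i ω) * q i ω := fun i ω =>
      le_convexComb (ha01 i ω).1 (ha01 i ω).2 (hp01 i ω).1 (hq01 i ω).1
    have h1 : ∀ i ω, a i ω * p i ω + (1 - a i ω) * q i ω ≤ 1 := fun i ω =>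
      convexComb_le (ha01 i ω).1 (ha01 i ω).2 (hp01 i ω).2 (hq01 i ω).2
    simp only [hr]
    rw [ofReal_integral_eq_lintegral_ofReal]
    · refine lintegral_congr fun ω => ?_
      rw [ENNReal.ofReal_prod_of_nonneg fun i _ => h0 i ω]
    · refine Integrable.of_bound (C := 1) (Finset.measurable_fun_prod _ fun i _ =>
        ((ha i).mul ((hp i).mono hm le_rfl)).add
          (((ha i).const_sub 1).mul ((hq i).mono hm le_rfl))).aestronglyMeasurable
        (Eventually.of_forall fun ω => norm_prod_le_one fun i => ?_)
      rw [abs_of_nonneg (h0 i ω)]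
      exact h1 i ω
    · exact Eventually.of_forall fun ω => Finset.prod_nonneg fun i _ => h0 i ω
  rw [hconv b hb hb01, hconv ρ hρ hρ01,
    integral_prod_mixture hm hb hρ hp hq hb01 hρ01 hp01 hq01 hlaw n]

end ConditionalMixing

/-! ### The network: Laplace functional, convergence, absence of atoms. -/

section Network

variable {Ω : Type*} [MeasurableSpace Ω] {μ : Measure Ω} [IsProbabilityMeasure μ]
  {lam c₁ c₂ α ℓ : ℝ} {N : ℕ} {η : Measure ℝ}
  {X : ℕ → Ω → Plane} {H : ℕ → Ω → ℝ} {B : ℕ → Ω → Bool} {G : ℕ → Ω → ℝ}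

lemma norm_position_rpow (x : Plane) (h α : ℝ) :
    ‖position x h‖ ^ (-α) = (‖x‖ ^ 2 + h ^ 2) ^ (-(α / 2)) := by
  rw [position, WithLp.prod_norm_eq_of_L2, Real.sqrt_eq_rpow, ← Real.rpow_mul (by positivity)]
  simp only [Real.norm_eq_abs, sq_abs]
  congr 1; ring

lemma linkFactor_nonneg (hℓ : 0 ≤ ℓ) (b : Bool) : 0 ≤ linkFactor ℓ b := by
  unfold linkFactor; split_ifs <;> [exact zero_le_one; exact hℓ]

/-- The product of the link factor and the path gain of a node. -/
noncomputable def pathGain (α ℓ : ℝ) (u : Plane × ℝ × Bool) : ℝ :=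
  linkFactor ℓ u.2.2 * (‖u.1‖ ^ 2 + u.2.1 ^ 2) ^ (-(α / 2))

lemma measurable_pathGain : Measurable (pathGain α ℓ) := by
  unfold pathGain
  have h : Measurable (linkFactor ℓ) := Measurable.of_discrete
  exact (h.comp (by fun_prop)).mul (by fun_prop)

lemma pathGain_nonneg (hℓ : 0 ≤ ℓ) (u : Plane × ℝ × Bool) : 0 ≤ pathGain α ℓ u :=
  mul_nonneg (linkFactor_nonneg hℓ _) (by positivity)

omit [MeasurableSpace Ω] in
lemma signal_eq (i : ℕ) (ω : Ω) :
    signal α ℓ X H B G i ω = pathGain α ℓ (X i ω, H i ω, B i ω) * G i ω := by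
  rw [signal, norm_position_rpow, pathGain]; ring

lemma lintegral_exp_neg_gain (hN : 1 ≤ N) {a : ℝ} (ha : 0 ≤ a) :
    ∫⁻ g, ENNReal.ofReal (Real.exp (-(a * (g / N)))) ∂(gammaMeasure N 1)
      = ENNReal.ofReal (gammaTransform N a) := by
  have hN' : (0 : ℝ) < N := by exact_mod_cast hN
  have h := lintegral_exp_neg_gammaMeasure (a := N) (r := 1) (c := a / N) hN' one_pos
    (by positivity)
  have h1 : ∀ g : ℝ, a * (g / N) = a / N * g := fun g => by ring
  simp only [h1, h]
  rw [gammaTransform_eq, Real.rpow_natCast, one_div, inv_pow]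

namespace IsAPDLNetwork

variable (hnet : IsAPDLNetwork μ lam η c₁ c₂ N X H B G)
include hnet

omit [IsProbabilityMeasure μ] in
lemma measurable_node (i : ℕ) : Measurable fun ω => (X i ω, H i ω, B i ω) :=
  (hnet.projections.measurable i).prodMk
    ((hnet.measurable_altitude i).prodMk (hnet.measurable_los i))

lemma isProbabilityMeasure_altitude : IsProbabilityMeasure η :=
  hnet.altitude_law 0 ▸ Measure.isProbabilityMeasure_map (hnet.measurable_altitude 0).aemeasurable

omit [IsProbabilityMeasure μ] in
lemma measurable_signal (i : ℕ) : Measurable (signal α ℓ X H B (fun i ω => G i ω / N) i) := by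
  have : signal α ℓ X H B (fun i ω => G i ω / N) i =
      fun ω => pathGain α ℓ (X i ω, H i ω, B i ω) * (G i ω / N) := funext (signal_eq i)
  rw [this]
  exact (measurable_pathGain.comp (hnet.measurable_node i)).mul
    ((hnet.measurable_gain i).div_const _)

omit [IsProbabilityMeasure μ] in
lemma ae_gain_pos : ∀ᵐ ω ∂μ, ∀ i, 0 < G i ω := by
  refine ae_all_iff.2 fun i => ?_
  have h := ae_pos_gammaMeasure N 1
  rw [← hnet.gain_law i] at h
  exact ae_of_ae_map (hnet.measurable_gain i).aemeasurable h

omit [IsProbabilityMeasure μ] in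
lemma ae_signal_nonneg (hℓ : 0 ≤ ℓ) :
    ∀ᵐ ω ∂μ, ∀ i, 0 ≤ signal α ℓ X H B (fun i ω => G i ω / N) i ω := by
  filter_upwards [hnet.ae_gain_pos] with ω hω i
  rw [signal_eq]
  exact mul_nonneg (pathGain_nonneg hℓ _) (div_nonneg (hω i).le (Nat.cast_nonneg _))

lemma lintegral_prod_signal_eq_pathGain (hN : 1 ≤ N) (hℓ : 0 ≤ ℓ) {s : ℝ} (hs : 0 ≤ s) (n : ℕ) :
    ∫⁻ ω, ∏ i ∈ Finset.range n,
        ENNReal.ofReal (Real.exp (-(s * signal α ℓ X H B (fun i ω => G i ω / N) i ω))) ∂μ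
      = ∫⁻ ω, ∏ i ∈ Finset.range n, ENNReal.ofReal
          (gammaTransform N (s * pathGain α ℓ (X i ω, H i ω, B i ω))) ∂μ := by
  have hk : Measurable (Function.uncurry fun (u : Plane × ℝ × Bool) (g : ℝ) =>
      ENNReal.ofReal (Real.exp (-(s * pathGain α ℓ u * (g / N))))) := by
    have : Measurable (pathGain α ℓ) := measurable_pathGain
    have h2 : Measurable fun p : (Plane × ℝ × Bool) × ℝ => pathGain α ℓ p.1 :=
      this.comp measurable_fst
    refine ENNReal.measurable_ofReal.comp (Real.measurable_exp.comp ?_)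
    exact ((h2.const_mul s).mul (measurable_snd.div_const _)).neg
  have h := lintegral_prod_of_indep_marks (fun i => hnet.measurable_node i) hnet.measurable_gain
    hnet.gain_law hnet.gain_indep hnet.gain_indep_rest hk n
  simp only [fun u => lintegral_exp_neg_gain hN (mul_nonneg hs (pathGain_nonneg (α := α) hℓ u))]
    at h
  simpa only [signal_eq, mul_assoc] using h

lemma lintegral_prod_pathGain (hc₂ : 0 < c₂) (hℓ : 0 ≤ ℓ) {s : ℝ} (hs : 0 ≤ s)
    (n : ℕ) : ∫⁻ ω, ∏ i ∈ Finset.range n, ENNReal.ofReal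
          (gammaTransform N (s * pathGain α ℓ (X i ω, H i ω, B i ω))) ∂μ
      = ∫⁻ ω, ∏ i ∈ Finset.range n, ENNReal.ofReal
          (linkTransform c₁ c₂ α ℓ N s ‖X i ω‖ (H i ω)) ∂μ := by
  have hXH : Measurable fun ω i => (X i ω, H i ω) := measurable_pi_iff.2 fun i =>
    (hnet.projections.measurable i).prodMk (hnet.measurable_altitude i)
  have hw : Measurable fun u : Plane × ℝ => s * (‖u.1‖ ^ 2 + u.2 ^ 2) ^ (-(α / 2)) := by fun_prop
  have hw0 : ∀ u : Plane × ℝ, 0 ≤ s * (‖u.1‖ ^ 2 + u.2 ^ 2) ^ (-(α / 2)) := fun u =>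
    mul_nonneg hs (Real.rpow_nonneg (by positivity) _)
  have hcoord : ∀ i, Measurable[MeasurableSpace.comap (fun ω i => (X i ω, H i ω)) inferInstance]
      fun ω => (X i ω, H i ω) := fun i =>
    (measurable_pi_apply i).comp (comap_measurable fun ω i => (X i ω, H i ω))
  have hwm : ∀ i, Measurable[MeasurableSpace.comap (fun ω i => (X i ω, H i ω)) inferInstance]
      fun ω => s * (‖X i ω‖ ^ 2 + H i ω ^ 2) ^ (-(α / 2)) := by
    intro i
    have h := hw.comp (hcoord i)
    exact h
  have key := lintegral_prod_mixture hXH.comap_le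
    (b := fun i ω => if B i ω then (1 : ℝ) else 0)
    (ρ := fun i ω => losProb c₁ c₂ (elevation (X i ω) (H i ω)))
    (p := fun i ω => gammaTransform N (s * (‖X i ω‖ ^ 2 + H i ω ^ 2) ^ (-(α / 2))))
    (q := fun i ω => gammaTransform N (s * (‖X i ω‖ ^ 2 + H i ω ^ 2) ^ (-(α / 2)) * ℓ))
    (fun i => (Measurable.of_discrete (f := fun c : Bool => if c then (1 : ℝ) else 0)).comp
      (hnet.measurable_los i))
    (fun i => measurable_losProb.comp (Real.measurable_arctan.comp
      ((hnet.measurable_altitude i).div (hnet.projections.measurable i).norm)))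
    (fun i => (measurable_gammaTransform N).comp (hwm i))
    (fun i => (measurable_gammaTransform N).comp ((hwm i).mul_const ℓ))
    (fun i ω => by split_ifs <;> simp)
    (fun i ω => ⟨losProb_nonneg hc₂ _, losProb_le_one hc₂ _⟩)
    (fun i ω => ⟨gammaTransform_nonneg _ (hw0 (X i ω, H i ω)),
      gammaTransform_le_one _ (hw0 (X i ω, H i ω))⟩)
    (fun i ω => ⟨gammaTransform_nonneg _ (mul_nonneg (hw0 (X i ω, H i ω)) hℓ),
      gammaTransform_le_one _ (mul_nonneg (hw0 (X i ω, H i ω)) hℓ)⟩)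
    hnet.los_law n
  -- With `b` equal to 0 or 1 the mixture selects `p` or `q`, that is, link factor 1 or `ℓ`.
  refine Eq.trans (lintegral_congr fun ω => Finset.prod_congr rfl fun i _ => ?_) key
  cases B i ω <;> simp [pathGain, linkFactor, mul_assoc, mul_comm ℓ]

lemma lintegral_prod_linkTransform (s : ℝ) (n : ℕ) :
    ∫⁻ ω, ∏ i ∈ Finset.range n, ENNReal.ofReal
          (linkTransform c₁ c₂ α ℓ N s ‖X i ω‖ (H i ω)) ∂μ
      = ∫⁻ ω, ∏ i ∈ Finset.range n, ∫⁻ h, ENNReal.ofReal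
          (linkTransform c₁ c₂ α ℓ N s ‖X i ω‖ h) ∂η ∂μ := by
  have hk : Measurable (Function.uncurry fun (x : Plane) (h : ℝ) =>
      ENNReal.ofReal (linkTransform c₁ c₂ α ℓ N s ‖x‖ h)) :=
    ((measurable_linkTransform c₁ c₂ α ℓ N s).comp
      ((measurable_fst.norm).prodMk measurable_snd)).ennreal_ofReal
  exact lintegral_prod_of_indep_marks hnet.projections.measurable hnet.measurable_altitude
    hnet.altitude_law hnet.altitude_indep hnet.altitude_projection_indep hk n

/-- The Laplace functional of the received signal. -/
theorem lintegral_iInf_prod_signal (hlam : 0 < lam) (hc₂ : 0 < c₂) (hα : 2 < α)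
    (hℓ : ℓ ∈ Icc (0 : ℝ) 1) (hN : 1 ≤ N) {s : ℝ} (hs : 0 ≤ s) :
    ∫⁻ ω, ⨅ n, ∏ i ∈ Finset.range n,
        ENNReal.ofReal (Real.exp (-(s * signal α ℓ X H B (fun i ω => G i ω / N) i ω))) ∂μ
      = ENNReal.ofReal (Real.exp (-(Real.pi * lam *
          ∫ z in Ioi (0 : ℝ), defect c₁ c₂ α ℓ N η s √z))) := by
  have hη := hnet.isProbabilityMeasure_altitude
  have hD : Measurable (defect c₁ c₂ α ℓ N η s) := measurable_defect
  have hφ : Measurable fun x : Plane => ENNReal.ofReal (defect c₁ c₂ α ℓ N η s ‖x‖) :=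
    (hD.comp measurable_norm).ennreal_ofReal
  have hint := lintegral_defect (c₁ := c₁) (N := N) (η := η) hc₂ hα hℓ hs hlam
  have hpgf := hnet.projections.lintegral_iInf_prod hφ
    (fun x => ENNReal.ofReal_le_one.2 (defect_le_one hc₂ hℓ.1 hs))
    (by rw [hint]; exact ENNReal.ofReal_ne_top)
  rw [hint, ENNReal.toReal_ofReal (mul_nonneg (by positivity)
    (integral_nonneg fun z => defect_nonneg hc₂ hℓ.1 hs))] at hpgf
  -- Infimum and integral commute on both sides, so only finite products need comparing. On the
  -- signal side monotonicity holds merely almost everywhere, since gains are positive only almost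
  -- surely.
  rw [← hpgf, lintegral_iInf_ae, lintegral_iInf]
  · refine iInf_congr fun n => ?_
    rw [hnet.lintegral_prod_signal_eq_pathGain hN hℓ.1 hs, hnet.lintegral_prod_pathGain hc₂ hℓ.1 hs,
      hnet.lintegral_prod_linkTransform]
    simp only [ofReal_defect hc₂ hℓ.1 hs]
  · exact fun n => Finset.measurable_fun_prod _ fun i _ =>
      (hφ.comp (hnet.projections.measurable i)).const_sub _
  · exact fun k l hkl ω => antitone_prod_range (fun i => tsub_le_self) hkl
  · simp
  · exact fun n => Finset.measurable_fun_prod _ fun i _ =>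
      (Real.measurable_exp.comp ((hnet.measurable_signal i).const_mul s).neg).ennreal_ofReal
  · intro n
    filter_upwards [hnet.ae_signal_nonneg hℓ.1] with ω hω
    refine antitone_prod_range (fun i => ENNReal.ofReal_le_one.2 (Real.exp_le_one_iff.2 ?_))
      n.le_succ
    exact neg_nonpos.2 (mul_nonneg hs (hω i))
  · simp

lemma ae_summable_signal (hlam : 0 < lam) (hc₂ : 0 < c₂) (hα : 2 < α)
    (hℓ : ℓ ∈ Icc (0 : ℝ) 1) (hN : 1 ≤ N) :
    ∀ᵐ ω ∂μ, Summable fun i => signal α ℓ X H B (fun i ω => G i ω / N) i ω := by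
  have hη := hnet.isProbabilityMeasure_altitude
  refine ae_summable_of_laplace (fun i => hnet.measurable_signal i) (hnet.ae_signal_nonneg hℓ.1)
    (K := fun s => Real.pi * lam * ∫ z in Ioi (0 : ℝ), defect c₁ c₂ α ℓ N η s √z) ?_
    (fun s hs => hnet.lintegral_iInf_prod_signal hlam hc₂ hα hℓ hN (le_of_lt hs))
  simpa using (tendsto_integral_defect_sqrt (c₁ := c₁) (N := N) (η := η) hc₂ hα hℓ).const_mul
    (Real.pi * lam)

/-- The coefficients `pathGain / N` are functions of the nodes, hence independent of the gains;
summability identifies the real series with its `[0, ∞]` version. -/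
lemma measure_tsum_signal_eq (hℓ : 0 ≤ ℓ)
    (hsum : ∀ᵐ ω ∂μ, Summable fun i => signal α ℓ X H B (fun i ω => G i ω / N) i ω)
    {t : ℝ} (ht : 0 < t) :
    μ {ω | ∑' i, signal α ℓ X H B (fun i ω => G i ω / N) i ω = t} = 0 := by
  have hC : Measurable fun (u : ℕ → Plane × ℝ × Bool) i => pathGain α ℓ (u i) / N :=
    measurable_pi_iff.2 fun i =>
      (measurable_pathGain.comp (measurable_pi_apply i)).div_const _
  have h := measure_tsum_eq_zero (μ := μ)
    (C := fun i ω => pathGain α ℓ (X i ω, H i ω, B i ω) / N)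
    (fun i => (measurable_pathGain.comp (hnet.measurable_node i)).div_const _)
    hnet.measurable_gain (fun i => (ae_all_iff.1 hnet.ae_gain_pos) i)
    (fun i => by rw [hnet.gain_law i]; exact nullSingletonClass_gammaMeasure _ _)
    hnet.gain_indep (hnet.gain_indep_rest.comp hC measurable_id) ht
  refine measure_mono_null_ae ?_ h
  filter_upwards [hsum, hnet.ae_signal_nonneg hℓ] with ω hω1 hω2 hω3
  have h3 : ∑' i, signal α ℓ X H B (fun i ω => G i ω / N) i ω = t := hω3
  change ∑' i, ENNReal.ofReal (pathGain α ℓ (X i ω, H i ω, B i ω) / N * G i ω) = ENNReal.ofReal t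
  rw [← h3, ENNReal.ofReal_tsum_of_nonneg hω2 hω1]
  refine tsum_congr fun i => ?_
  rw [signal_eq]
  congr 1; ring

end IsAPDLNetwork

end Network

end CellFree

/-! ### The coverage formula. -/

open CellFree
theorem proposition4 {Ω : Type*} [MeasurableSpace Ω] (μ : Measure Ω) [IsProbabilityMeasure μ]
    (lam c₁ c₂ α ℓ P σ₀ β : ℝ) (N : ℕ) (η : Measure ℝ)
    (X : ℕ → Ω → Plane) (H : ℕ → Ω → ℝ) (B : ℕ → Ω → Bool) (G : ℕ → Ω → ℝ)
    (hlam : 0 < lam) (hc₁ : 0 < c₁) (hc₂ : 0 < c₂) (hα : 2 < α) (hℓ : ℓ ∈ Icc (0 : ℝ) 1)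
    (hP : 0 < P) (hσ₀ : 0 < σ₀) (hβ : 0 < β) (hN : 1 ≤ N)
    (hnet : IsAPDLNetwork μ lam η c₁ c₂ N X H B G) :
    -- the received signal is almost surely finite
    (∀ᵐ ω ∂μ, Summable fun i => signal α ℓ X H B G i ω) ∧
    -- the integral in the exponent converges
    (∀ s > 0, IntegrableOn
      (fun z => JG c₁ c₂ α ℓ N (s * z ^ (-(α / 2))) (angleLaw η z)) (Ioi 0)) ∧
    -- the inverse Laplace transform exists
    IsInverseLaplace (coverageTransform lam η c₁ c₂ α ℓ N)
      (inverseLaplace (coverageTransform lam η c₁ c₂ α ℓ N)) ∧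
    -- coverage with the gains `G i / N` of unit mean
    cellFreeCoverage μ P σ₀ β α ℓ X H B (fun i ω => G i ω / N) =
      1 - inverseLaplace (coverageTransform lam η c₁ c₂ α ℓ N) (β * σ₀ / P) ∧
    -- coverage with the gains `G i` themselves
    cellFreeCoverage μ P σ₀ β α ℓ X H B G =
      1 - inverseLaplace (coverageTransform lam η c₁ c₂ α ℓ N) (β * σ₀ / (N * P)) ∧
    -- the limit of a large number of antennas
    (∀ x : ℝ, 0 ≤ x → ∀ ν : Measure ℝ, IsProbabilityMeasure ν →
      (∀ᵐ y ∂ν, y ∈ Icc 0 (Real.pi / 2)) →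
      Tendsto (fun n : ℕ => JG c₁ c₂ α ℓ n x ν) atTop
        (𝓝 (1 - ∫ y, (losProb c₁ c₂ y * Real.exp (-(x * Real.cos y ^ α))
          + (1 - losProb c₁ c₂ y) * Real.exp (-(x * ℓ * Real.cos y ^ α))) ∂ν))) := by
  have hη := hnet.isProbabilityMeasure_altitude
  have hN' : (0 : ℝ) < N := by exact_mod_cast hN
  have hdef : ∀ s, ∫ z in Ioi (0 : ℝ), JG c₁ c₂ α ℓ N (s * z ^ (-(α / 2))) (angleLaw η z) =
      ∫ z in Ioi (0 : ℝ), defect c₁ c₂ α ℓ N η s √z := fun s =>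
    setIntegral_congr_fun measurableSet_Ioi fun z hz => JG_eq_defect hz c₁ c₂ α ℓ N s
  have hsum := hnet.ae_summable_signal (α := α) hlam hc₂ hα hℓ hN
  have hscale : ∀ i ω, signal α ℓ X H B G i ω =
      N * signal α ℓ X H B (fun i ω => G i ω / N) i ω := fun i ω => by
    rw [signal_eq, signal_eq]; field_simp
  set Z : Ω → ℝ := fun ω => ∑' i, signal α ℓ X H B (fun i ω => G i ω / N) i ω with hZ
  have hZm : Measurable Z := Measurable.tsum fun i => hnet.measurable_signal i
  have hZ0 : ∀ᵐ ω ∂μ, 0 ≤ Z ω := by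
    filter_upwards [hnet.ae_signal_nonneg hℓ.1] with ω hω using tsum_nonneg hω
  have hatom : ∀ t > 0, μ {ω | Z ω = t} = 0 := fun t ht =>
    hnet.measure_tsum_signal_eq hℓ.1 hsum ht
  have hinv : IsInverseLaplace (coverageTransform lam η c₁ c₂ α ℓ N)
      (fun t => μ.real {ω | Z ω ≤ t}) := by
    have h := isInverseLaplace_distributionFunction hZm.aemeasurable hZ0 hatom
      (L := fun s => Real.exp (-(Real.pi * lam *
        ∫ z in Ioi (0 : ℝ), defect c₁ c₂ α ℓ N η s √z)))
      (fun s _ => (Real.exp_pos _).le) (fun s hs => by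
        rw [← hnet.lintegral_iInf_prod_signal hlam hc₂ hα hℓ hN (le_of_lt hs)]
        refine lintegral_congr_ae ?_
        filter_upwards [hsum, hnet.ae_signal_nonneg hℓ.1] with ω hω1 hω2
        rw [iInf_prod_exp_neg (fun i => mul_nonneg (le_of_lt hs) (hω2 i)) (hω1.mul_left s),
          tsum_mul_left])
    have heq : coverageTransform lam η c₁ c₂ α ℓ N = fun s => 1 / s * Real.exp (-(Real.pi * lam *
        ∫ z in Ioi (0 : ℝ), defect c₁ c₂ α ℓ N η s √z)) := by
      ext s; rw [coverageTransform, hdef]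
    rwa [heq]
  have hinv' := isInverseLaplace_inverseLaplace hinv
  have htail : ∀ t > 0, μ.real {ω | t ≤ Z ω} =
      1 - inverseLaplace (coverageTransform lam η c₁ c₂ α ℓ N) t := by
    intro t ht
    -- Lerch's theorem replaces the chosen inverse by the distribution function of `Z`. The events
    -- `t ≤ Z` and `t < Z` then differ by a null atom.
    rw [hinv'.eqOn hinv ht]
    have h1 : {ω | t ≤ Z ω} =ᵐ[μ] ({ω | Z ω ≤ t}ᶜ : Set Ω) := by
      have h2 : ∀ᵐ ω ∂μ, Z ω ≠ t := by simpa [ae_iff] using hatom t ht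
      filter_upwards [h2] with ω hω
      apply propext
      change t ≤ Z ω ↔ ¬ (Z ω ≤ t)
      rw [not_le]
      exact ⟨fun h => lt_of_le_of_ne h hω.symm, le_of_lt⟩
    rw [measureReal_congr h1, probReal_compl_eq_one_sub (measurableSet_le hZm measurable_const)]
  refine ⟨?_, fun s hs => ?_, hinv', ?_, ?_, fun x hx ν hν hν' => ?_⟩
  · filter_upwards [hsum] with ω hω
    simp only [hscale]
    exact hω.mul_left _
  · exact (integrableOn_defect_sqrt hc₂ hα hℓ (le_of_lt hs)).congr_fun
      (fun z hz => (JG_eq_defect hz c₁ c₂ α ℓ N s).symm) measurableSet_Ioi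
  · rw [← htail _ (by positivity), cellFreeCoverage]
    congr 1
    ext ω
    change β ≤ P * Z ω / σ₀ ↔ β * σ₀ / P ≤ Z ω
    rw [le_div_iff₀ hσ₀, div_le_iff₀ hP, mul_comm P]
  · rw [← htail _ (by positivity), cellFreeCoverage]
    congr 1
    ext ω
    -- The raw gains multiply `Z` by `N`, which moves into the threshold.
    have h1 : ∑' i, signal α ℓ X H B G i ω = N * Z ω := by
      simp only [hscale, hZ, tsum_mul_left]
    change β ≤ P * (∑' i, signal α ℓ X H B G i ω) / σ₀ ↔ β * σ₀ / (N * P) ≤ Z ω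
    rw [h1, le_div_iff₀ hσ₀, div_le_iff₀ (by positivity),
      show P * (N * Z ω) = Z ω * (N * P) by ring]
  · exact tendsto_JG hc₂ hℓ hx ν hν'
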